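/- **Setting.** Let $d\in\{2,3\}$. A $d$-simplex $T$ is described by lengths $h_1,\dots,h_d>0$, a shape matrix $\widetilde A$, an orthogonal map $A_T\in O(d)$ and a vector $b_T\in\mathbb R^d$ as follows. * $d=2$: $\widehat T$ is the triangle with vertices $\hat p_1=(0,0)$, $\hat p_2=(1,0)$, $\hat p_3=(0,1)$, and $\widetilde A=\begin{pmatrix}1&s\\0&t\end{pmatrix}$ with $s^2+t^2=1$, $t>0$. * $d=3$, type (i): $\widehat T$ has vertices $\hat p_1=(0,0,0)$, $\hat p_2=(1,0,0)$, $\hat p_3=(0,1,0)$, $\hat p_4=(0,0,1)$, and $\widetilde A=\begin{pmatrix}1&s_1&s_{21}\\0&t_1&s_{22}\\0&0&t_2\end{pmatrix}$. Type (ii): the same with $\hat p_3=(1,1,0)$ and with $-s_1$ in place of $s_1$ in $\widetilde A$. In both types $s_1^2+t_1^2=1$, $s_1,t_1>0$, $h_2s_1\le h_1/2$, $s_{21}^2+s_{22}^2+t_2^2=1$, $t_2>0$, $h_3s_{21}\le h_1/2$. Put $\Phi_T(\tilde x)=A_T\tilde x+b_T$, $\Phi(\hat x)=\Phi_T\big(\widetilde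 A\,\mathrm{diag}(h_1,\dots,h_d)\,\hat x\big)$, $T=\Phi(\widehat T)$, $p_i=\Phi(\hat p_i)$. The vertices are assumed to be labelled as follows. For $d=2$: $p_2p_3$ is a longest edge, and $h_2=|p_1-p_3|\le h_1=|p_1-p_2|$. For $d=3$: a shortest edge $L_{\min}$ is $p_1p_3$ for type (i) and $p_2p_3$ for type (ii); $p_1p_2$ is a longest one of the four edges sharing exactly one endpoint with $L_{\min}$; with respect to the plane through the midpoint of $p_1p_2$ perpendicular to $p_2-p_1$, $p_4$ lies in the closed half-space of $p_1$, while $p_3$ lies in that of $p_1$ for type (i) and in that of $p_2$ for type (ii). Let $r_1=\frac{p_2-p_1}{|p_2-p_1|}$, $r_2=\frac{p_3-p_1}{|p_3-p_1|}$ (but $r_2=\frac{p_3-p_2}{|p_3-p_2|}$ for type (ii)), $r_3=\frac{p_4-p_1}{|p_4-p_1|}$ if $d=3$, and $\frac{\partial\varphi}{\partial r_i}=r_i\cdot\nabla\varphi$ (weak derivatives). Let $\widetilde{\mathscr H}_1=h_1$, $\widetilde{\mathscr H}_2=h_2t$ if $d=2$, and $\widetilde{\mathscr H}_1=h_1$,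 $\widetilde{\mathscr H}_2=h_2t_1$, $\widetilde{\mathscr H}_3=h_3t_2$ if $d=3$. Let $\Pi_T^0\varphi=\frac1{|T|}\int_T\varphi\,dx$. **Theorem.** Let $p,q\in[1,\infty]$. (a) There is a constant $c$, depending only on $d,p,q$, such that for every such $T$ with $W^{1,p}(T)\hookrightarrow L^q(T)$ (continuous embedding) and every $\hat\varphi\in W^{1,p}(\widehat T)$, with $\varphi=\hat\varphi\circ\Phi^{-1}$, $$\|\Pi_T^0\varphi-\varphi\|_{L^q(T)}\le c\,|T|^{\frac1q-\frac1p}\sum_{i=1}^d h_i\Big\|\frac{\partial\varphi}{\partial r_i}\Big\|_{L^p(T)}.$$ (b) For every $M>0$ there is a constant $c$, depending only on $d,p,q,M$, such that for every such $T$ with $W^{1,p}(T)\hookrightarrow L^q(T)$ which, if $d=3$, satisfies $|s_{22}|\le M\frac{h_2t_1}{h_3}$ (no condition if $d=2$), and every $\hat\varphi\in W^{1,p}(\widehat T)$, with $\varphi=\hat\varphi\circ\Phi^{-1}$, $$\|\Pi_T^0\varphi-\varphi\|_{L^q(T)}\le c\,|T|^{\frac1q-\frac1p}\sum_{i=1}^d\widetilde{\mathscr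 H}_i\Big\|\frac{\partial(\varphi\circ\Phi_T)}{\partial\tilde x_i}\Big\|_{L^p(\Phi_T^{-1}(T))}.$$ -/

import Mathlib

open MeasureTheory
open scoped ENNReal NNReal ContDiff

noncomputable section

namespace AnisotropicMean

/-- Euclidean space `ℝ^d`. -/
abbrev E (d : ℕ) := EuclideanSpace ℝ (Fin d)

/-! ### Sobolev functions of order one on a closed set `K` (through the open set `interior K`) -/

/-- `g` is the weak partial derivative `∂f/∂x_i` on the open set `U`. -/
def HasWeakPartial {d : ℕ} (U : Set (E d)) (i : Fin d) (f g : E d → ℝ) : Prop :=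
  LocallyIntegrableOn f U ∧ LocallyIntegrableOn g U ∧
    ∀ ψ : E d → ℝ, ContDiff ℝ ∞ ψ → HasCompactSupport ψ → tsupport ψ ⊆ U →
      ∫ x, f x * fderiv ℝ ψ x (EuclideanSpace.single i 1) = -∫ x, g x * ψ x

open Classical in
/-- The weak partial derivative `∂f/∂x_i` on the interior of `K`: any function that is one
(it is unique almost everywhere on the interior of `K`), and `0` if there is none. -/
def weakPartial {d : ℕ} (K : Set (E d)) (i : Fin d) (f : E d → ℝ) : E d → ℝ :=
  if h : ∃ g, HasWeakPartial (interior K) i f g then h.choose else 0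

/-- The directional derivative `∂f/∂r = ∑ k, r_k ∂f/∂x_k`. -/
def weakDirDeriv {d : ℕ} (K : Set (E d)) (r : E d) (f : E d → ℝ) : E d → ℝ :=
  fun x => ∑ k, r k * weakPartial K k f x

/-- The norm of `L^p(K)`, with values in `[0, ∞]`. -/
def normLp {d : ℕ} (K : Set (E d)) (p : ℝ≥0∞) (f : E d → ℝ) : ℝ≥0∞ :=
  eLpNorm f p (volume.restrict K)

/-- `f ∈ W^{1,p}(K)`: `f` lies in `L^p(K)` and so do its weak partial derivatives. -/
def MemW1 {d : ℕ} (K : Set (E d)) (p : ℝ≥0∞) (f : E d → ℝ) : Prop :=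
  MemLp f p (volume.restrict K) ∧
    ∀ i, ∃ g, HasWeakPartial (interior K) i f g ∧ MemLp g p (volume.restrict K)

/-- A norm of `W^{1,p}(K)`. -/
def normW1 {d : ℕ} (K : Set (E d)) (p : ℝ≥0∞) (f : E d → ℝ) : ℝ≥0∞ :=
  normLp K p f + ∑ i, normLp K p (weakPartial K i f)

/-- The continuous embedding `W^{1,p}(K) ↪ L^q(K)`. -/
def W1EmbedsLp {d : ℕ} (K : Set (E d)) (p q : ℝ≥0∞) : Prop :=
  ∃ C : ℝ≥0, ∀ f : E d → ℝ, MemW1 K p f →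
    MemLp f q (volume.restrict K) ∧ normLp K q f ≤ C * normW1 K p f

/-- The mean-value projection: `Π_K^0 f = |K|⁻¹ ∫_K f`. -/
def meanProj {d : ℕ} (K : Set (E d)) (f : E d → ℝ) : ℝ := ⨍ x in K, f x

/-! ### Shape parameters, reference elements, affine maps -/

/-- The shape parameters of a triangle, and of a tetrahedron of type (i) or (ii). -/
inductive Shape : ℕ → Type
  | triangle (s t : ℝ) : Shape 2
  | tetraI (s₁ t₁ s₂₁ s₂₂ t₂ : ℝ) : Shape 3
  | tetraII (s₁ t₁ s₂₁ s₂₂ t₂ : ℝ) : Shape 3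

namespace Shape

/-- The vertices of the reference element. -/
def refVertex : {d : ℕ} → Shape d → Fin (d + 1) → E d
  | _, triangle _ _ => ![!₂[0, 0], !₂[1, 0], !₂[0, 1]]
  | _, tetraI _ _ _ _ _ => ![!₂[0, 0, 0], !₂[1, 0, 0], !₂[0, 1, 0], !₂[0, 0, 1]]
  | _, tetraII _ _ _ _ _ => ![!₂[0, 0, 0], !₂[1, 0, 0], !₂[1, 1, 0], !₂[0, 0, 1]]

/-- The closed reference element. -/
def refElement {d : ℕ} (S : Shape d) : Set (E d) := convexHull ℝ (Set.range S.refVertex)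

/-- The matrix of shape parameters. -/
def matrix : {d : ℕ} → Shape d → Matrix (Fin d) (Fin d) ℝ
  | _, triangle s t => !![1, s; 0, t]
  | _, tetraI s₁ t₁ s₂₁ s₂₂ t₂ => !![1, s₁, s₂₁; 0, t₁, s₂₂; 0, 0, t₂]
  | _, tetraII s₁ t₁ s₂₁ s₂₂ t₂ => !![1, -s₁, s₂₁; 0, t₁, s₂₂; 0, 0, t₂]

/-- The constraints on the parameters of a tetrahedron. -/
def TetraAdmissible (h : Fin 3 → ℝ) (s₁ t₁ s₂₁ s₂₂ t₂ : ℝ) : Prop :=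
  s₁ ^ 2 + t₁ ^ 2 = 1 ∧ 0 < s₁ ∧ 0 < t₁ ∧ h 1 * s₁ ≤ h 0 / 2 ∧
    s₂₁ ^ 2 + s₂₂ ^ 2 + t₂ ^ 2 = 1 ∧ 0 < t₂ ∧ h 2 * s₂₁ ≤ h 0 / 2

/-- The constraints on the shape parameters, given the lengths `h`. -/
def Admissible : {d : ℕ} → Shape d → (Fin d → ℝ) → Prop
  | _, triangle s t, _ => s ^ 2 + t ^ 2 = 1 ∧ 0 < t
  | _, tetraI s₁ t₁ s₂₁ s₂₂ t₂, h => TetraAdmissible h s₁ t₁ s₂₁ s₂₂ t₂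
  | _, tetraII s₁ t₁ s₂₁ s₂₂ t₂, h => TetraAdmissible h s₁ t₁ s₂₁ s₂₂ t₂

/-- The closed half-space that contains `a` and is bounded by the hyperplane through the midpoint
of `a` and `b` perpendicular to `b - a`. -/
def halfSpace {d : ℕ} (a b : E d) : Set (E d) :=
  {x | inner ℝ (x - midpoint ℝ a b) (b - a) ≤ 0}

/-- The conditions on the labelling of the vertices `v 0, …, v d` of the element.
Triangle: the edge `v 1 v 2` is a longest one, and `|v 0 v 2| ≤ |v 0 v 1|`.
Tetrahedron: the shortest edge `L` is `v 0 v 2` for type (i) and `v 1 v 2` for type (ii); `v 0 v 1`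
is a longest one among the four edges that share exactly one endpoint with `L`; `v 3` is in the
half-space of `v 0`; and `v 2` is in the half-space of `v 0` for type (i), of `v 1` for
type (ii). -/
def VertexCondition : {d : ℕ} → Shape d → (Fin (d + 1) → E d) → Prop
  | _, triangle _ _, v =>
      dist (v 0) (v 1) ≤ dist (v 1) (v 2) ∧ dist (v 0) (v 2) ≤ dist (v 1) (v 2) ∧
        dist (v 0) (v 2) ≤ dist (v 0) (v 1)
  | _, tetraI _ _ _ _ _, v =>
      (∀ i j, i ≠ j → dist (v 0) (v 2) ≤ dist (v i) (v j)) ∧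
      dist (v 0) (v 3) ≤ dist (v 0) (v 1) ∧ dist (v 1) (v 2) ≤ dist (v 0) (v 1) ∧
      dist (v 2) (v 3) ≤ dist (v 0) (v 1) ∧
      v 2 ∈ halfSpace (v 0) (v 1) ∧ v 3 ∈ halfSpace (v 0) (v 1)
  | _, tetraII _ _ _ _ _, v =>
      (∀ i j, i ≠ j → dist (v 1) (v 2) ≤ dist (v i) (v j)) ∧
      dist (v 0) (v 2) ≤ dist (v 0) (v 1) ∧ dist (v 1) (v 3) ≤ dist (v 0) (v 1) ∧
      dist (v 2) (v 3) ≤ dist (v 0) (v 1) ∧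
      v 2 ∈ halfSpace (v 1) (v 0) ∧ v 3 ∈ halfSpace (v 0) (v 1)

/-- The weights: `h_1, h_2 t` for triangles, `h_1, h_2 t_1, h_3 t_2` for tetrahedra. -/
def weight : {d : ℕ} → Shape d → (Fin d → ℝ) → Fin d → ℝ
  | _, triangle _ t, h => ![h 0, h 1 * t]
  | _, tetraI _ t₁ _ _ t₂, h => ![h 0, h 1 * t₁, h 2 * t₂]
  | _, tetraII _ t₁ _ _ t₂, h => ![h 0, h 1 * t₁, h 2 * t₂]

/-- The additional geometric condition with constant `M` (void for triangles). -/
def GeomAssumption : {d : ℕ} → Shape d → (Fin d → ℝ) → ℝ → Prop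
  | _, triangle _ _, _, _ => True
  | _, tetraI _ t₁ _ s₂₂ _, h, M => |s₂₂| ≤ M * (h 1 * t₁ / h 2)
  | _, tetraII _ t₁ _ s₂₂ _, h, M => |s₂₂| ≤ M * (h 1 * t₁ / h 2)

/-- The unit direction vectors `r_1, …, r_d` along edges. -/
def dir : {d : ℕ} → Shape d → (Fin (d + 1) → E d) → Fin d → E d
  | _, triangle _ _, v =>
      ![(dist (v 1) (v 0))⁻¹ • (v 1 - v 0), (dist (v 2) (v 0))⁻¹ • (v 2 - v 0)]
  | _, tetraI _ _ _ _ _, v =>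
      ![(dist (v 1) (v 0))⁻¹ • (v 1 - v 0), (dist (v 2) (v 0))⁻¹ • (v 2 - v 0),
        (dist (v 3) (v 0))⁻¹ • (v 3 - v 0)]
  | _, tetraII _ _ _ _ _, v =>
      ![(dist (v 1) (v 0))⁻¹ • (v 1 - v 0), (dist (v 2) (v 1))⁻¹ • (v 2 - v 1),
        (dist (v 3) (v 0))⁻¹ • (v 3 - v 0)]

theorem det_matrix_ne_zero {d : ℕ} (S : Shape d) (h : Fin d → ℝ) (hS : S.Admissible h) :
    S.matrix.det ≠ 0 := by
  cases S with
  | triangle s t =>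
    have := hS.2
    simp [matrix, Matrix.det_fin_two, this.ne']
  | tetraI s₁ t₁ s₂₁ s₂₂ t₂ =>
    obtain ⟨-, -, h1, -, -, h2, -⟩ := hS
    simp [matrix, Matrix.det_fin_three, h1.ne', h2.ne']
  | tetraII s₁ t₁ s₂₁ s₂₂ t₂ =>
    obtain ⟨-, -, h1, -, -, h2, -⟩ := hS
    simp [matrix, Matrix.det_fin_three, h1.ne', h2.ne']

/-- The linear map from the reference element to the element in standard position: the shape matrix
times `diag (h_1, …, h_d)`. -/
def linMap {d : ℕ} (S : Shape d) (h : Fin d → ℝ) : E d → E d :=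
  fun x => WithLp.toLp 2 ((S.matrix * Matrix.diagonal h).mulVec x.ofLp)

/-- The affine map `x ↦ A x + b` from the standard position to the element, `A ∈ O(d)`. -/
def rigidMap {d : ℕ} (A : E d ≃ₗᵢ[ℝ] E d) (b : E d) : E d → E d := fun x => A x + b

end Shape

/-- A `d`-simplex, with all the data that describe it: shape parameters, lengths `h_1, …, h_d`, a
linear isometry `A ∈ O(d)` and a translation vector `b`. -/
structure Element (d : ℕ) where
  shape : Shape d
  h : Fin d → ℝ
  A : E d ≃ₗᵢ[ℝ] E d
  b : E d
  h_pos : ∀ i, 0 < h i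
  admissible : shape.Admissible h
  vertexCondition : shape.VertexCondition fun i =>
    Shape.rigidMap A b (shape.linMap h (shape.refVertex i))

namespace Element

variable {d : ℕ} (T : Element d)

/-- The rigid motion `Φ_T` from the standard position to the element. -/
def rigid : E d → E d := Shape.rigidMap T.A T.b

/-- The map from the reference element to the element. -/
def toMap : E d → E d := fun x => T.rigid (T.shape.linMap T.h x)

/-- The vertices of the element. -/
def vertex (i : Fin (d + 1)) : E d := T.toMap (T.shape.refVertex i)

/-- The element as a closed set: the image of the reference element. -/
def carrier : Set (E d) := T.toMap '' T.shape.refElement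

/-- The unit direction vectors `r_1, …, r_d` of the element. -/
def dir : Fin d → E d := T.shape.dir T.vertex

theorem toMap_bijective : Function.Bijective T.toMap := by
  have hdet : IsUnit (T.shape.matrix * Matrix.diagonal T.h) := by
    rw [Matrix.isUnit_iff_isUnit_det, Matrix.det_mul, Matrix.det_diagonal, isUnit_iff_ne_zero]
    exact mul_ne_zero (T.shape.det_matrix_ne_zero T.h T.admissible)
      (Finset.prod_ne_zero_iff.2 fun i _ => (T.h_pos i).ne')
  have h1 : Function.Bijective (T.shape.linMap T.h) := by
    have h2 : Function.Bijective (T.shape.matrix * Matrix.diagonal T.h).mulVec :=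
      ⟨Matrix.mulVec_injective_iff_isUnit.2 hdet, Matrix.mulVec_surjective_iff_isUnit.2 hdet⟩
    exact (WithLp.equiv 2 (Fin d → ℝ)).symm.bijective.comp
      (h2.comp (WithLp.equiv 2 (Fin d → ℝ)).bijective)
  exact ((Equiv.addRight T.b).bijective.comp T.A.bijective).comp h1

/-- The map from the reference element to the element, as a bijection of `ℝ^d`. -/
def toEquiv : E d ≃ E d := Equiv.ofBijective T.toMap T.toMap_bijective

end Element

end AnisotropicMean

end

noncomputable section

namespace AnisotropicMean

/-! ### Integral inequalities for smooth functions on convex sets -/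

/-! Only three reference elements occur, whatever the shape parameters. It is enough to prove one
inequality ‖mean f − f‖_q ≤ C ∑ ‖∂_i f‖_p on each of them and to transport it by affine maps F,
keeping track of every factor.

On the reference element, a Poincaré inequality (`exists_poincare`) gives a constant a with ‖f −
a‖_p ≤ C ∑ ‖∂_i f‖_p. The embedding into L^q, applied to f − a, upgrades the left side to the L^q
norm, and the mean value is as good as any constant up to a factor
(`exists_normLp_meanProj_sub_le`). The embedding is assumed on T only, but it is affine invariant
(`W1EmbedsLp.preimage_affine`), so it holds on the reference element whenever it holds on some T.

The Poincaré inequality is proved by hand. For finite p and smooth u on a bounded convex set, |u(x)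
− u(y)|^p is bounded by an integral of |∇u|^p over the segment; integrating over x and y and
contracting towards one end point bounds the double integral. Mollification on inner parallel sets,
which stay convex, and Fatou's lemma extend this to weakly differentiable f, and a is the value of f
at a suitable point. For p = ∞ the segment argument is applied pointwise.

Under F the Jacobian factors combine to |T|^(1/q − 1/p), and ∂_k(f ∘ F) is the derivative of f along
the vector F e_k, with F taken without its translation (`exists_normLp_meanProj_sub_le_affine`). In
(a), F is the full map and F e_k = h_k r_k. In (b), F is the linear map into standard position; the
labelling of the vertices and the condition on s₂₂ bound the i-th coordinate of F e_k by (2 + M)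
times the i-th weight (`Element.abs_matrix_mul_le`). -/

theorem rpow_lintegral_le_lintegral_rpow {α : Type*} [MeasurableSpace α] {μ : Measure α}
    [IsProbabilityMeasure μ] {f : α → ℝ≥0∞} (hf : AEMeasurable f μ) {p : ℝ} (hp : 1 ≤ p) :
    (∫⁻ a, f a ∂μ) ^ p ≤ ∫⁻ a, f a ^ p ∂μ := by
  have h0 : 0 < p := by linarith
  have h := eLpNorm'_le_eLpNorm'_of_exponent_le (ε := ℝ≥0∞) (μ := μ) (f := f) one_pos hp
    hf.aestronglyMeasurable
  simp only [eLpNorm', enorm_eq_self, ENNReal.rpow_one, div_one] at h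
  calc (∫⁻ a, f a ∂μ) ^ p ≤ ((∫⁻ a, f a ^ p ∂μ) ^ (1 / p)) ^ p := by gcongr
    _ = _ := by rw [← ENNReal.rpow_mul, one_div_mul_cancel h0.ne', ENNReal.rpow_one]

theorem enorm_sub_le_lintegral_fderiv {F : Type*} [NormedAddCommGroup F] [NormedSpace ℝ F]
    {u : F → ℝ} (hu : ContDiff ℝ 1 u) (x y : F) :
    ‖u x - u y‖ₑ ≤ ‖x - y‖ₑ * ∫⁻ t in Set.Ioc (0 : ℝ) 1, ‖fderiv ℝ u (y + t • (x - y))‖ₑ := by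
  have hline : ∀ t : ℝ, HasDerivAt (fun t : ℝ => y + t • (x - y)) (x - y) t := fun t => by
    simpa using ((hasDerivAt_id t).smul_const (x - y)).const_add y
  have hd : ∀ t : ℝ, HasDerivAt (fun t : ℝ => u (y + t • (x - y)))
      (fderiv ℝ u (y + t • (x - y)) (x - y)) t := fun t =>
    ((hu.differentiable one_ne_zero _).hasFDerivAt.comp_hasDerivAt t (hline t))
  have hc : Continuous fun t : ℝ => fderiv ℝ u (y + t • (x - y)) :=
    (hu.continuous_fderiv one_ne_zero).comp (by fun_prop)
  have hftc := intervalIntegral.integral_eq_sub_of_hasDerivAt (a := 0) (b := 1)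
    (fun t _ => hd t) ((hc.clm_apply continuous_const).intervalIntegrable 0 1)
  have e : u x - u y = ∫ t in (0 : ℝ)..1, fderiv ℝ u (y + t • (x - y)) (x - y) := by
    rw [hftc]; simp
  rw [e, intervalIntegral.integral_of_le zero_le_one]
  refine (enorm_integral_le_lintegral_enorm _).trans ?_
  rw [← lintegral_const_mul _ hc.enorm.measurable]
  refine lintegral_mono fun t => ?_
  rw [mul_comm]
  exact ContinuousLinearMap.le_opENorm _ _

section Convex

variable {F : Type*} [NormedAddCommGroup F] [NormedSpace ℝ F] [FiniteDimensional ℝ F]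
  [MeasurableSpace F] [BorelSpace F] {μ : Measure F}

/-- The probability measure with density the normalized bump function. -/
def bumpMeasure (μ : Measure F) (ϕ : ContDiffBump (0 : F)) : Measure F :=
  μ.withDensity fun t => ENNReal.ofReal (ϕ.normed μ t)

/-- Mollification is an average against a probability measure, so that Jensen's inequality becomes
available. -/
theorem enorm_convolution_le (ϕ : ContDiffBump (0 : F)) {g : F → ℝ} (hg : Measurable g) (x : F) :
    ‖convolution (ϕ.normed μ) g (ContinuousLinearMap.lsmul ℝ ℝ) μ x‖ₑ ≤
      ∫⁻ t, ‖g (x - t)‖ₑ ∂bumpMeasure μ ϕ := by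
  have hm : Measurable fun t => ENNReal.ofReal (ϕ.normed μ t) :=
    ϕ.continuous_normed.measurable.ennreal_ofReal
  have hgx : Measurable fun t => ‖g (x - t)‖ₑ := (hg.comp (measurable_const_sub x)).enorm
  rw [bumpMeasure, lintegral_withDensity_eq_lintegral_mul _ hm hgx]
  refine (enorm_integral_le_lintegral_enorm _).trans (lintegral_mono fun t => ?_)
  simp only [ContinuousLinearMap.lsmul_apply, smul_eq_mul, enorm_mul, Pi.mul_apply]
  rw [Real.enorm_of_nonneg (ϕ.nonneg_normed t)]

variable [μ.IsAddHaarMeasure]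

/-- Convexity makes the homothety map V into itself, and its inverse Jacobian s^(−n) is at most 2^n
because s stays away from 0. -/
theorem lintegral_homothety_le {V : Set F} (hV : Convex ℝ V) (hVm : MeasurableSet V) {a : F}
    (ha : a ∈ V) {H : F → ℝ≥0∞} (hH : Measurable H) {s : ℝ} (hs : 1 / 2 ≤ s) (hs1 : s ≤ 1) :
    ∫⁻ x in V, H (a + s • (x - a)) ∂μ ≤ 2 ^ Module.finrank ℝ F * ∫⁻ x in V, H x ∂μ := by
  have hs0 : 0 < s := by linarith
  have hind : Measurable (V.indicator H) := hH.indicator hVm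
  calc ∫⁻ x in V, H (a + s • (x - a)) ∂μ
      ≤ ∫⁻ x, V.indicator H (a + s • (x - a)) ∂μ := by
        rw [← lintegral_indicator hVm]
        refine lintegral_mono fun x => ?_
        by_cases hx : x ∈ V
        · have : a + s • (x - a) ∈ V := hV.add_smul_sub_mem ha hx ⟨hs0.le, hs1⟩
          simp [hx, this]
        · simp [hx]
    _ = ∫⁻ x, V.indicator H (a + s • x) ∂μ :=
        lintegral_sub_right_eq_self (fun x => V.indicator H (a + s • x)) a
    _ = ∫⁻ z, V.indicator H (a + z) ∂(Measure.map (fun x => s • x) μ) :=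
        (lintegral_map (f := fun z => V.indicator H (a + z))
          (hind.comp (measurable_const_add a)) (measurable_const_smul s)).symm
    _ = ENNReal.ofReal |(s ^ Module.finrank ℝ F)⁻¹| * ∫⁻ x in V, H x ∂μ := by
        rw [Measure.map_addHaar_smul μ hs0.ne', lintegral_smul_measure,
          lintegral_add_left_eq_self (fun z => V.indicator H z) a, lintegral_indicator hVm,
          smul_eq_mul]
    _ ≤ _ := by
        gcongr
        rw [abs_of_pos (by positivity), ← inv_pow]
        have h2 : (2 : ℝ≥0∞) ^ Module.finrank ℝ F
            = ENNReal.ofReal (2 ^ Module.finrank ℝ F) := by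
          rw [ENNReal.ofReal_pow (by norm_num)]; norm_num
        rw [h2]
        refine ENNReal.ofReal_le_ofReal ?_
        gcongr
        rw [inv_le_comm₀ hs0 (by norm_num)]
        linarith

/-- Integrate the gradient along the segment from y to x, apply Jensen in the parameter t, and
exchange the integrals so that t is outermost. For each t the point y + t(x − y) is then a
homothetic image of x or of y. -/
theorem lintegral_lintegral_sub_rpow_le {V : Set F} (hV : Convex ℝ V) (hVm : MeasurableSet V)
    {D : ℝ≥0∞} (hD : ∀ x ∈ V, ∀ y ∈ V, ‖x - y‖ₑ ≤ D) {u : F → ℝ} (hu : ContDiff ℝ 1 u)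
    {p : ℝ} (hp : 1 ≤ p) :
    ∫⁻ x in V, ∫⁻ y in V, ‖u x - u y‖ₑ ^ p ∂μ ∂μ ≤
      D ^ p * (2 ^ Module.finrank ℝ F * μ V * ∫⁻ x in V, ‖fderiv ℝ u x‖ₑ ^ p ∂μ) := by
  have hp0 : 0 ≤ p := by linarith
  set H : F → ℝ≥0∞ := fun x => ‖fderiv ℝ u x‖ₑ ^ p with hH
  have hHm : Measurable H := ((hu.continuous_fderiv one_ne_zero).enorm.measurable).pow_const p
  set I := ∫⁻ x in V, H x ∂μ
  have hprob : IsProbabilityMeasure (volume.restrict (Set.Ioc (0 : ℝ) 1)) := ⟨by simp⟩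
  have hpt : ∀ x ∈ V, ∀ y ∈ V, ‖u x - u y‖ₑ ^ p ≤
      D ^ p * ∫⁻ t in Set.Ioc (0 : ℝ) 1, H (y + t • (x - y)) := by
    intro x hx y hy
    have hc : Continuous fun t : ℝ => ‖fderiv ℝ u (y + t • (x - y))‖ₑ :=
      ((hu.continuous_fderiv one_ne_zero).comp (by fun_prop)).enorm
    calc ‖u x - u y‖ₑ ^ p
        ≤ (‖x - y‖ₑ * ∫⁻ t in Set.Ioc (0 : ℝ) 1, ‖fderiv ℝ u (y + t • (x - y))‖ₑ) ^ p := by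
          gcongr; exact enorm_sub_le_lintegral_fderiv hu x y
      _ = ‖x - y‖ₑ ^ p * (∫⁻ t in Set.Ioc (0 : ℝ) 1, ‖fderiv ℝ u (y + t • (x - y))‖ₑ) ^ p :=
          ENNReal.mul_rpow_of_nonneg _ _ hp0
      _ ≤ _ := by
          gcongr
          · exact hD x hx y hy
          · exact rpow_lintegral_le_lintegral_rpow hc.measurable.aemeasurable hp
  have hm3 : Measurable fun z : (F × F) × ℝ => H (z.1.2 + z.2 • (z.1.1 - z.1.2)) :=
    hHm.comp (by fun_prop : Continuous _).measurable
  have hm2 : ∀ t : ℝ, Measurable fun z : F × F => H (z.2 + t • (z.1 - z.2)) := fun t =>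
    hHm.comp (by fun_prop : Continuous _).measurable
  have key : ∀ t ∈ Set.Ioc (0 : ℝ) 1, ∫⁻ x in V, ∫⁻ y in V, H (y + t • (x - y)) ∂μ ∂μ ≤
      2 ^ Module.finrank ℝ F * μ V * I := by
    intro t ht
    have hconst : ∫⁻ _ in V, 2 ^ Module.finrank ℝ F * I ∂μ = 2 ^ Module.finrank ℝ F * μ V * I := by
      rw [setLIntegral_const]; ring
    -- The ratio must be at least 1/2: for t ≥ 1/2 freeze y and contract x towards it with ratio t,
    -- otherwise freeze x and contract y with ratio 1 − t.
    rcases le_total (1 / 2) t with h | h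
    · rw [lintegral_lintegral_swap (hm2 t).aemeasurable, ← hconst]
      exact setLIntegral_mono measurable_const fun y hy =>
        lintegral_homothety_le (μ := μ) hV hVm hy hHm h ht.2
    · rw [← hconst]
      refine setLIntegral_mono measurable_const fun x hx => ?_
      have := lintegral_homothety_le (μ := μ) hV hVm hx hHm (s := 1 - t) (by linarith)
        (by linarith [ht.1])
      refine le_trans (le_of_eq ?_) this
      refine lintegral_congr fun y => ?_
      congr 1
      module
  calc ∫⁻ x in V, ∫⁻ y in V, ‖u x - u y‖ₑ ^ p ∂μ ∂μ
      ≤ ∫⁻ x in V, ∫⁻ y in V, D ^ p * (∫⁻ t in Set.Ioc (0 : ℝ) 1, H (y + t • (x - y))) ∂μ ∂μ :=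
        setLIntegral_mono' hVm fun x hx => setLIntegral_mono' hVm fun y hy => hpt x hx y hy
    _ = D ^ p * ∫⁻ z, (∫⁻ t in Set.Ioc (0 : ℝ) 1, H (z.2 + t • (z.1 - z.2)))
          ∂((μ.restrict V).prod (μ.restrict V)) := by
        rw [← lintegral_const_mul _ (Measurable.lintegral_prod_right' hm3),
          lintegral_prod _ ((Measurable.lintegral_prod_right' hm3).const_mul _).aemeasurable]
    _ = D ^ p * ∫⁻ t in Set.Ioc (0 : ℝ) 1, ∫⁻ x in V, ∫⁻ y in V, H (y + t • (x - y)) ∂μ ∂μ := by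
        rw [lintegral_lintegral_swap hm3.aemeasurable]
        congr 1
        exact lintegral_congr fun t => lintegral_prod _ (hm2 t).aemeasurable
    _ ≤ D ^ p * ∫⁻ t in Set.Ioc (0 : ℝ) 1, 2 ^ Module.finrank ℝ F * μ V * I := by
        gcongr _ * ?_
        exact setLIntegral_mono' measurableSet_Ioc key
    _ = _ := by simp

/-! ### Mollification -/

theorem isProbabilityMeasure_bumpMeasure (ϕ : ContDiffBump (0 : F)) :
    IsProbabilityMeasure (bumpMeasure μ ϕ) := by
  refine ⟨?_⟩
  rw [bumpMeasure, withDensity_apply _ MeasurableSet.univ, setLIntegral_univ,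
    ← ofReal_integral_eq_lintegral_ofReal ϕ.integrable_normed
      (Filter.Eventually.of_forall fun t => ϕ.nonneg_normed t), ϕ.integral_normed,
    ENNReal.ofReal_one]

/-- Young's inequality for a kernel of mass one: Jensen, Tonelli and translation invariance. A
measurable representative of `g` is used for Tonelli. -/
theorem lintegral_convolution_bump_rpow_le (ϕ : ContDiffBump (0 : F)) {g : F → ℝ}
    (hg : AEStronglyMeasurable g μ) {p : ℝ} (hp : 1 ≤ p) :
    ∫⁻ x, ‖convolution (ϕ.normed μ) g (ContinuousLinearMap.lsmul ℝ ℝ) μ x‖ₑ ^ p ∂μ ≤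
      ∫⁻ x, ‖g x‖ₑ ^ p ∂μ := by
  have := isProbabilityMeasure_bumpMeasure (μ := μ) ϕ
  obtain ⟨g', hg', hgg'⟩ := hg
  rw [convolution_congr (μ := μ) _ (Filter.EventuallyEq.refl _ (ϕ.normed μ)) hgg']
  have hR : ∫⁻ x, ‖g x‖ₑ ^ p ∂μ = ∫⁻ x, ‖g' x‖ₑ ^ p ∂μ :=
    lintegral_congr_ae (hgg'.mono fun x hx => by simp only [hx])
  have hg'm := hg'.measurable
  have hm : Measurable fun z : F × F => ‖g' (z.1 - z.2)‖ₑ ^ p :=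
    ((hg'm.comp (measurable_fst.sub measurable_snd)).enorm).pow_const p
  rw [hR]
  calc _ ≤ ∫⁻ x, ∫⁻ t, ‖g' (x - t)‖ₑ ^ p ∂bumpMeasure μ ϕ ∂μ := by
        refine lintegral_mono fun x => ?_
        refine le_trans ?_ (rpow_lintegral_le_lintegral_rpow
          (hg'm.comp (measurable_const_sub x)).enorm.aemeasurable hp)
        gcongr
        exact enorm_convolution_le ϕ hg'm x
    _ = ∫⁻ t, ∫⁻ x, ‖g' (x - t)‖ₑ ^ p ∂μ ∂bumpMeasure μ ϕ :=
        lintegral_lintegral_swap hm.aemeasurable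
    _ = ∫⁻ t, ∫⁻ x, ‖g' x‖ₑ ^ p ∂μ ∂bumpMeasure μ ϕ :=
        lintegral_congr fun t => lintegral_sub_right_eq_self (fun x => ‖g' x‖ₑ ^ p) t
    _ = _ := by simp

/-- The bound holds at every point, not only almost everywhere, so it can be integrated along a
segment. -/
theorem enorm_convolution_bump_le_eLpNorm_top (ϕ : ContDiffBump (0 : F)) {g : F → ℝ}
    (hg : AEStronglyMeasurable g μ) (x : F) :
    ‖convolution (ϕ.normed μ) g (ContinuousLinearMap.lsmul ℝ ℝ) μ x‖ₑ ≤ eLpNorm g ∞ μ := by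
  have := isProbabilityMeasure_bumpMeasure (μ := μ) ϕ
  obtain ⟨g', hg', hgg'⟩ := hg
  rw [convolution_congr (μ := μ) _ (Filter.EventuallyEq.refl _ (ϕ.normed μ)) hgg',
    eLpNorm_congr_ae hgg', eLpNorm_exponent_top]
  refine (enorm_convolution_le ϕ hg'.measurable x).trans ?_
  have hae : ∀ᵐ t ∂bumpMeasure μ ϕ, ‖g' (x - t)‖ₑ ≤ eLpNormEssSup g' μ := by
    refine (withDensity_absolutelyContinuous μ _).ae_le ?_
    exact (quasiMeasurePreserving_sub_left μ x).ae (enorm_ae_le_eLpNormEssSup g' μ)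
  calc _ ≤ ∫⁻ _, eLpNormEssSup g' μ ∂bumpMeasure μ ϕ := lintegral_mono_ae hae
    _ = _ := by simp

end Convex

/-! ### Mollification of weakly differentiable functions -/

theorem integral_indicator_mul_of_support_subset {d : ℕ} {U : Set (E d)} {f ψ : E d → ℝ}
    (h : Function.support ψ ⊆ U) : ∫ y, U.indicator f y * ψ y = ∫ y, f y * ψ y := by
  refine integral_congr_ae (Filter.Eventually.of_forall fun y => ?_)
  by_cases hy : y ∈ U
  · simp [hy]
  · have : ψ y = 0 := by by_contra h0; exact hy (h h0)
    simp [this]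

/-- Differentiate the kernel and use y ↦ η(x − y) as test function. The condition on the ball keeps
its support inside U, where the zero extension of f is not seen. -/
theorem HasWeakPartial.fderiv_convolution {d : ℕ} {U : Set (E d)} {i : Fin d} {f g : E d → ℝ}
    (h : HasWeakPartial U i f g) (hf : LocallyIntegrable (U.indicator f))
    (ϕ : ContDiffBump (0 : E d)) {x : E d} (hx : Metric.closedBall x ϕ.rOut ⊆ U) :
    fderiv ℝ (convolution (ϕ.normed volume) (U.indicator f) (ContinuousLinearMap.lsmul ℝ ℝ)
      volume) x (EuclideanSpace.single i 1) =
      convolution (ϕ.normed volume) (U.indicator g) (ContinuousLinearMap.lsmul ℝ ℝ) volume x := by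
  set e : E d := EuclideanSpace.single i 1
  set η : E d → ℝ := ϕ.normed volume with hη
  have hηc : ContDiff ℝ ∞ η := ϕ.contDiff_normed
  have hηs : HasCompactSupport η := ϕ.hasCompactSupport_normed
  have hη1 : ContDiff ℝ 1 η := ϕ.contDiff_normed
  set ψ : E d → ℝ := fun y => η (x - y) with hψ
  have hψc : ContDiff ℝ ∞ ψ := hηc.comp (contDiff_const.sub contDiff_id)
  have hψt : tsupport ψ ⊆ Metric.closedBall x ϕ.rOut := by
    refine closure_minimal (fun y hy => ?_) Metric.isClosed_closedBall
    have hy' : x - y ∈ Function.support η := hy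
    rw [hη, ϕ.support_normed_eq, mem_ball_zero_iff] at hy'
    rw [Metric.mem_closedBall, dist_comm, dist_eq_norm]
    exact hy'.le
  have hψs : HasCompactSupport ψ :=
    (isCompact_closedBall x ϕ.rOut).of_isClosed_subset (isClosed_tsupport ψ) hψt
  have hψd : ∀ y, fderiv ℝ ψ y e = - fderiv ℝ η (x - y) e := fun y => by
    have h1 : HasFDerivAt (fun y : E d => x - y) (-ContinuousLinearMap.id ℝ (E d)) y :=
      (hasFDerivAt_id y).const_sub x
    have h2 := ((hη1.differentiable one_ne_zero (x - y)).hasFDerivAt.comp y h1).fderiv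
    change fderiv ℝ ψ y = _ at h2
    rw [h2]; simp
  have hmain := h.2.2 ψ hψc hψs (hψt.trans hx)
  rw [(hηs.hasFDerivAt_convolution_left (ContinuousLinearMap.lsmul ℝ ℝ) hη1 hf x).fderiv]
  have e1 : (convolution (fderiv ℝ η) (U.indicator f)
      (ContinuousLinearMap.precompL (E d) (ContinuousLinearMap.lsmul ℝ ℝ)) volume x) e =
      ∫ y, fderiv ℝ η (x - y) e * U.indicator f y := by
    have hint := ((hηs.fderiv ℝ).convolutionExists_left
        (ContinuousLinearMap.precompL (E d) (ContinuousLinearMap.lsmul ℝ ℝ (E := ℝ)))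
        (hη1.continuous_fderiv one_ne_zero) hf x).integrable_swap
    rw [convolution_eq_swap]
    refine (ContinuousLinearMap.integral_apply hint e).trans ?_
    simp only [ContinuousLinearMap.precompL_apply, ContinuousLinearMap.lsmul_apply, smul_eq_mul]
  have hs1 : Function.support (fun y => fderiv ℝ ψ y e) ⊆ U :=
    fun y hy => hx (hψt (support_fderiv_subset ℝ fun h0 => hy (by
      change fderiv ℝ ψ y e = 0; rw [h0]; rfl)))
  have hs2 : Function.support ψ ⊆ U := (subset_tsupport ψ).trans (hψt.trans hx)
  rw [e1, convolution_eq_swap]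
  calc ∫ y, fderiv ℝ η (x - y) e * U.indicator f y
      = - ∫ y, U.indicator f y * fderiv ℝ ψ y e := by
        rw [← integral_neg]; congr 1; ext y; rw [hψd]; ring
    _ = ∫ y, g y * ψ y := by
        rw [integral_indicator_mul_of_support_subset hs1, hmain, neg_neg]
    _ = ∫ y, U.indicator g y * ψ y := (integral_indicator_mul_of_support_subset hs2).symm
    _ = _ := by congr 1; ext y; simp [hψ, mul_comm]

theorem opENorm_le_sum_single {d : ℕ} (L : E d →L[ℝ] ℝ) :
    ‖L‖ₑ ≤ ∑ i, ‖L (EuclideanSpace.single i 1)‖ₑ := by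
  have h : ‖L‖ ≤ ∑ i, ‖L (EuclideanSpace.single i 1)‖ := by
    refine L.opNorm_le_bound (Finset.sum_nonneg fun _ _ => norm_nonneg _) fun x => ?_
    have hx : x = ∑ i, x i • (EuclideanSpace.single i 1 : E d) := by
      ext j; simp [Pi.single_apply]
    conv_lhs => rw [hx, map_sum]
    refine (norm_sum_le _ _).trans ?_
    rw [Finset.sum_mul]
    refine Finset.sum_le_sum fun i _ => ?_
    rw [map_smul, norm_smul, mul_comm]
    gcongr
    exact PiLp.norm_apply_le x i
  have h2 := ENNReal.ofReal_le_ofReal h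
  rw [ENNReal.ofReal_sum_of_nonneg fun _ _ => norm_nonneg _] at h2
  simpa only [ofReal_norm] using h2

/-- The points whose closed `ε`-ball is contained in `U`. -/
def innerParallel {d : ℕ} (U : Set (E d)) (ε : ℝ) : Set (E d) := {x | Metric.closedBall x ε ⊆ U}

/-- A point of the ball around a x + b y is the same combination of x + w and y + w for one common
small w. -/
theorem convex_innerParallel {d : ℕ} {U : Set (E d)} (hU : Convex ℝ U) (ε : ℝ) :
    Convex ℝ (innerParallel U ε) := by
  intro x hx y hy a b ha hb hab z hz
  have hz' : ‖z - (a • x + b • y)‖ ≤ ε := by simpa [dist_eq_norm] using hz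
  set w := z - (a • x + b • y)
  have e : z = a • (x + w) + b • (y + w) := by
    have : z = a • x + b • y + (a + b) • w := by rw [hab]; simp [w]
    rw [this]; module
  rw [e]
  exact hU (hx (by simpa using hz')) (hy (by simpa using hz')) ha hb hab

theorem innerParallel_subset {d : ℕ} {U : Set (E d)} {ε : ℝ} (hε : 0 ≤ ε) :
    innerParallel U ε ⊆ U := fun _ hx => hx (Metric.mem_closedBall_self hε)

theorem isOpen_innerParallel {d : ℕ} {U : Set (E d)} (hU : IsOpen U) (ε : ℝ) :
    IsOpen (innerParallel U ε) := by
  rw [Metric.isOpen_iff]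
  intro x hx
  obtain ⟨δ, hδ, h⟩ := (isCompact_closedBall x ε).exists_cthickening_subset_open hU hx
  refine ⟨δ, hδ, fun y hy z hz => h ?_⟩
  rcases lt_or_ge ε 0 with hε | hε
  · rw [Metric.closedBall_eq_empty.2 hε] at hz; exact hz.elim
  rw [cthickening_closedBall hδ.le hε]
  rw [Metric.mem_closedBall] at hz ⊢
  rw [Metric.mem_ball] at hy
  linarith [dist_triangle z y x]

theorem eventually_mem_innerParallel {d : ℕ} {U : Set (E d)} (hU : IsOpen U) {x : E d}
    (hx : x ∈ U) {r : ℕ → ℝ} (hr : Filter.Tendsto r Filter.atTop (nhds 0)) :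
    ∀ᶠ n in Filter.atTop, x ∈ innerParallel U (r n) := by
  obtain ⟨ε, hε, h⟩ := Metric.nhds_basis_closedBall.mem_iff.1 (hU.mem_nhds hx)
  filter_upwards [hr.eventually (gt_mem_nhds hε)] with n hn
  exact (Metric.closedBall_subset_closedBall hn.le).trans h

/-- A sequence of bump functions around the origin shrinking to a point. -/
def bumpSeq (d n : ℕ) : ContDiffBump (0 : E d) where
  rIn := 1 / (n + 1)
  rOut := 2 / (n + 1)
  rIn_pos := by positivity
  rIn_lt_rOut := by gcongr; norm_num

theorem tendsto_bumpSeq_rOut (d : ℕ) :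
    Filter.Tendsto (fun n => (bumpSeq d n).rOut) Filter.atTop (nhds 0) := by
  have := (tendsto_one_div_add_atTop_nhds_zero_nat (𝕜 := ℝ)).const_mul 2
  simpa [bumpSeq, div_eq_mul_inv] using this

/-- Lebesgue differentiation; it needs the ratio of outer to inner radius to stay bounded, and here
it is always 2. -/
theorem ae_tendsto_convolution_bumpSeq {d : ℕ} {f : E d → ℝ} (hf : LocallyIntegrable f) :
    ∀ᵐ x, Filter.Tendsto (fun n => convolution ((bumpSeq d n).normed volume) f
      (ContinuousLinearMap.lsmul ℝ ℝ) volume x) Filter.atTop (nhds (f x)) :=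
  ContDiffBump.ae_convolution_tendsto_right_of_locallyIntegrable (K := 2)
    (tendsto_bumpSeq_rOut d) (Filter.Eventually.of_forall fun n => by
      simp [bumpSeq, div_eq_mul_inv]) hf

/-! ### The Poincaré inequality on a bounded convex open set -/

section Poincare

variable {d : ℕ} {U : Set (E d)}

theorem locallyIntegrable_indicator_of_memLp (hUo : IsOpen U) (hUb : Bornology.IsBounded U)
    {p : ℝ≥0∞} (hp : 1 ≤ p) {f : E d → ℝ} (hf : MemLp f p (volume.restrict U)) :
    LocallyIntegrable (U.indicator f) := by
  have : IsFiniteMeasure (volume.restrict U) := ⟨by simpa using hUb.measure_lt_top⟩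
  have h : IntegrableOn f U := hf.integrable hp
  exact ((integrable_indicator_iff hUo.measurableSet).2 h).locallyIntegrable

theorem exists_enorm_sub_le (hUb : Bornology.IsBounded U) :
    ∃ D : ℝ≥0, ∀ x ∈ U, ∀ y ∈ U, ‖x - y‖ₑ ≤ D := by
  refine ⟨(Metric.diam U).toNNReal, fun x hx y hy => ?_⟩
  rw [← ofReal_norm, ← dist_eq_norm]
  exact ENNReal.ofReal_le_ofReal (Metric.dist_le_diam_of_mem hUb hx hy)

/-- The mollification of `f`, extended by zero outside of `U`. -/
def mollify (U : Set (E d)) (f : E d → ℝ) (n : ℕ) : E d → ℝ :=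
  convolution ((bumpSeq d n).normed volume) (U.indicator f) (ContinuousLinearMap.lsmul ℝ ℝ) volume

theorem contDiff_mollify {f : E d → ℝ} (hf : LocallyIntegrable (U.indicator f)) (n : ℕ) :
    ContDiff ℝ 1 (mollify U f n) :=
  (bumpSeq d n).hasCompactSupport_normed.contDiff_convolution_left (n := 1) _
    (bumpSeq d n).contDiff_normed hf

theorem ae_tendsto_mollify (hUo : IsOpen U) {f : E d → ℝ}
    (hf : LocallyIntegrable (U.indicator f)) :
    ∀ᵐ x ∂volume.restrict U,
      Filter.Tendsto (fun n => mollify U f n x) Filter.atTop (nhds (f x)) := by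
  rw [ae_restrict_iff' hUo.measurableSet]
  filter_upwards [ae_tendsto_convolution_bumpSeq hf] with x hx hxU
  simpa [hxU, mollify] using hx

theorem enorm_fderiv_mollify_le {f : E d → ℝ} {g : Fin d → E d → ℝ}
    (hf : LocallyIntegrable (U.indicator f)) (hg : ∀ i, HasWeakPartial U i f (g i)) {n : ℕ}
    {x : E d} (hx : x ∈ innerParallel U (bumpSeq d n).rOut) :
    ‖fderiv ℝ (mollify U f n) x‖ₑ ≤ ∑ i, ‖mollify U (g i) n x‖ₑ := by
  refine (opENorm_le_sum_single _).trans (le_of_eq ?_)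
  refine Finset.sum_congr rfl fun i _ => ?_
  congr 1
  exact (hg i).fderiv_convolution hf _ hx

/-- The constant is f(y) for one point y where the mollifications converge. For almost every x, the
whole segment from y to x lies in the convex inner parallel set once n is large, and there the
gradient of the mollification is bounded uniformly. -/
theorem exists_eLpNorm_top_sub_const_le (hUo : IsOpen U) (hUc : Convex ℝ U)
    (hUn : U.Nonempty) {D : ℝ≥0} (hD : ∀ x ∈ U, ∀ y ∈ U, ‖x - y‖ₑ ≤ D) {f : E d → ℝ}
    {g : Fin d → E d → ℝ} (hf : LocallyIntegrable (U.indicator f))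
    (hg : ∀ i, HasWeakPartial U i f (g i)) (hgp : ∀ i, MemLp (g i) ∞ (volume.restrict U)) :
    ∃ a : ℝ, eLpNorm (fun x => f x - a) ∞ (volume.restrict U) ≤
      D * ∑ i, eLpNorm (g i) ∞ (volume.restrict U) := by
  have hae := ae_tendsto_mollify hUo hf
  have hne : volume.restrict U ≠ 0 := by
    rw [Ne, Measure.restrict_eq_zero]
    exact (hUo.measure_pos volume hUn).ne'
  have : (ae (volume.restrict U)).NeBot := ae_neBot.2 hne
  obtain ⟨y, hy, hyU⟩ := (hae.and (ae_restrict_mem hUo.measurableSet)).exists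
  refine ⟨f y, ?_⟩
  rw [eLpNorm_exponent_top]
  refine eLpNormEssSup_le_of_ae_enorm_bound ?_
  filter_upwards [hae, ae_restrict_mem hUo.measurableSet] with x hx hxU
  refine le_of_tendsto ((hx.sub hy).enorm) ?_
  filter_upwards [eventually_mem_innerParallel hUo hxU (tendsto_bumpSeq_rOut d),
    eventually_mem_innerParallel hUo hyU (tendsto_bumpSeq_rOut d)] with n hxn hyn
  refine (enorm_sub_le_lintegral_fderiv (contDiff_mollify hf n) x y).trans ?_
  gcongr
  · exact hD x hxU y hyU
  calc _ ≤ ∫⁻ _ in Set.Ioc (0 : ℝ) 1, ∑ i, eLpNorm (g i) ∞ (volume.restrict U) := by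
        refine setLIntegral_mono' measurableSet_Ioc fun t ht => ?_
        refine (enorm_fderiv_mollify_le hf hg
          ((convex_innerParallel hUc _).add_smul_sub_mem hyn hxn ⟨ht.1.le, ht.2⟩)).trans ?_
        refine Finset.sum_le_sum fun i _ => ?_
        rw [← eLpNorm_indicator_eq_eLpNorm_restrict hUo.measurableSet]
        refine enorm_convolution_bump_le_eLpNorm_top _ ?_ _
        exact (aestronglyMeasurable_indicator_iff hUo.measurableSet).2 (hgp i).1
    _ = _ := by simp

theorem lintegral_fderiv_mollify_le (hUo : IsOpen U) {f : E d → ℝ} {g : Fin d → E d → ℝ}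
    (hf : LocallyIntegrable (U.indicator f)) (hg : ∀ i, HasWeakPartial U i f (g i))
    (hgl : ∀ i, LocallyIntegrable (U.indicator (g i))) {r : ℝ} (hr : 1 ≤ r) (n : ℕ) :
    ∫⁻ x in innerParallel U (bumpSeq d n).rOut, ‖fderiv ℝ (mollify U f n) x‖ₑ ^ r ≤
      (d : ℝ≥0∞) ^ (r - 1) * ∑ i, ∫⁻ x in U, ‖g i x‖ₑ ^ r := by
  have hr0 : 0 < r := by linarith
  have hgi : ∀ i, Measurable fun x => ‖mollify U (g i) n x‖ₑ ^ r := fun i =>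
    ((contDiff_mollify (hgl i) n).continuous.enorm.measurable).pow_const r
  calc _ ≤ ∫⁻ x, (d : ℝ≥0∞) ^ (r - 1) * ∑ i, ‖mollify U (g i) n x‖ₑ ^ r := by
        refine (setLIntegral_mono' (isOpen_innerParallel hUo _).measurableSet fun x hx => ?_).trans
          (setLIntegral_le_lintegral _ _)
        calc _ ≤ (∑ i, ‖mollify U (g i) n x‖ₑ) ^ r := by
              gcongr; exact enorm_fderiv_mollify_le hf hg hx
          _ ≤ _ := by
              simpa using ENNReal.rpow_sum_le_const_mul_sum_rpow Finset.univ
                (fun i => ‖mollify U (g i) n x‖ₑ) hr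
    _ = (d : ℝ≥0∞) ^ (r - 1) * ∑ i, ∫⁻ x, ‖mollify U (g i) n x‖ₑ ^ r := by
        rw [lintegral_const_mul _ (Finset.measurable_sum _ fun i _ => hgi i),
          lintegral_finsetSum _ fun i _ => hgi i]
    _ ≤ _ := by
        gcongr _ * ?_
        refine Finset.sum_le_sum fun i _ => ?_
        refine (lintegral_convolution_bump_rpow_le (bumpSeq d n) (hgl i).aestronglyMeasurable hr).trans (le_of_eq ?_)
        rw [← lintegral_indicator hUo.measurableSet]
        refine lintegral_congr fun x => ?_
        by_cases hx : x ∈ U <;> simp [hx, hr0]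

/-- Apply the smooth inequality to the mollifications on the inner parallel sets, with a bound
independent of n, and pass to the limit by Fatou. The cut-offs `G n` converge because these sets
exhaust U. -/
theorem lintegral_prod_sub_rpow_le_of_hasWeakPartial (hUo : IsOpen U) (hUc : Convex ℝ U)
    {D : ℝ≥0} (hD : ∀ x ∈ U, ∀ y ∈ U, ‖x - y‖ₑ ≤ D) {f : E d → ℝ}
    {g : Fin d → E d → ℝ} (hf : LocallyIntegrable (U.indicator f))
    (hg : ∀ i, HasWeakPartial U i f (g i))
    (hgl : ∀ i, LocallyIntegrable (U.indicator (g i))) {r : ℝ} (hr : 1 ≤ r) :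
    ∫⁻ z, ‖f z.1 - f z.2‖ₑ ^ r ∂((volume.restrict U).prod (volume.restrict U)) ≤
      (D : ℝ≥0∞) ^ r * (2 ^ d * volume U *
        ((d : ℝ≥0∞) ^ (r - 1) * ∑ i, ∫⁻ x in U, ‖g i x‖ₑ ^ r)) := by
  set V : ℕ → Set (E d) := fun n => innerParallel U (bumpSeq d n).rOut with hV
  have hVm : ∀ n, MeasurableSet (V n) := fun n => (isOpen_innerParallel hUo _).measurableSet
  have hVU : ∀ n, V n ⊆ U := fun n => innerParallel_subset (bumpSeq d n).rOut_pos.le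
  set G : ℕ → E d × E d → ℝ≥0∞ := fun n =>
    (V n ×ˢ V n).indicator fun z => ‖mollify U f n z.1 - mollify U f n z.2‖ₑ ^ r with hG
  have hmol : ∀ n, Measurable fun z : E d × E d =>
      ‖mollify U f n z.1 - mollify U f n z.2‖ₑ ^ r := fun n => by
    have := (contDiff_mollify hf n).continuous
    exact ((by fun_prop : Continuous fun z : E d × E d =>
      mollify U f n z.1 - mollify U f n z.2).enorm.measurable).pow_const r
  have hGm : ∀ n, Measurable (G n) := fun n => (hmol n).indicator ((hVm n).prod (hVm n))
  have hae := (ae_tendsto_mollify hUo hf).and (ae_restrict_mem hUo.measurableSet)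
  have hlim : ∀ᵐ z ∂((volume.restrict U).prod (volume.restrict U)),
      ‖f z.1 - f z.2‖ₑ ^ r = Filter.liminf (fun n => G n z) Filter.atTop := by
    filter_upwards [Measure.quasiMeasurePreserving_fst.ae hae,
      Measure.quasiMeasurePreserving_snd.ae hae] with z hz1 hz2
    refine (Filter.Tendsto.liminf_eq ?_).symm
    have ht := ((hz1.1.sub hz2.1).enorm).ennrpow_const r
    refine ht.congr' ?_
    filter_upwards [eventually_mem_innerParallel hUo hz1.2 (tendsto_bumpSeq_rOut d),
      eventually_mem_innerParallel hUo hz2.2 (tendsto_bumpSeq_rOut d)] with n h1 h2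
    have : z ∈ V n ×ˢ V n := ⟨h1, h2⟩
    simp [hG, this]
  rw [lintegral_congr_ae hlim]
  refine (lintegral_liminf_le hGm).trans ?_
  refine Filter.liminf_le_of_le (by isBoundedDefault) fun b hb => ?_
  obtain ⟨n, hn⟩ := hb.exists
  refine hn.trans ?_
  rw [hG, lintegral_indicator ((hVm n).prod (hVm n)), ← Measure.prod_restrict,
    Measure.restrict_restrict_of_subset (hVU n), lintegral_prod _ (hmol n).aemeasurable]
  refine (lintegral_lintegral_sub_rpow_le (convex_innerParallel hUc _) (hVm n)
    (fun x hx y hy => hD x (hVU n hx) y (hVU n hy)) (contDiff_mollify hf n) hr).trans ?_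
  rw [finrank_euclideanSpace_fin]
  gcongr
  · exact hVU n
  · exact lintegral_fderiv_mollify_le hUo hf hg hgl hr n

theorem exists_poincare (hUo : IsOpen U) (hUc : Convex ℝ U) (hUb : Bornology.IsBounded U)
    (hUn : U.Nonempty) {p : ℝ≥0∞} (hp : 1 ≤ p) :
    ∃ C : ℝ≥0, ∀ (f : E d → ℝ) (g : Fin d → E d → ℝ), MemLp f p (volume.restrict U) →
      (∀ i, HasWeakPartial U i f (g i)) → (∀ i, MemLp (g i) p (volume.restrict U)) →
      ∃ a : ℝ, eLpNorm (fun x => f x - a) p (volume.restrict U) ≤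
        C * ∑ i, eLpNorm (g i) p (volume.restrict U) := by
  obtain ⟨D, hD⟩ := exists_enorm_sub_le hUb
  rcases eq_or_ne p ∞ with rfl | hpt
  · exact ⟨D, fun f g hf hg hgp => exists_eLpNorm_top_sub_const_le hUo hUc hUn hD
      (locallyIntegrable_indicator_of_memLp hUo hUb hp hf) hg hgp⟩
  have hp0 : p ≠ 0 := (one_pos.trans_le hp).ne'
  set r := p.toReal with hrdef
  have hr : 1 ≤ r := by
    have := ENNReal.toReal_mono hpt hp
    simpa using this
  have hr0 : 0 < r := by linarith
  -- The factor 2^d comes from the homotheties, d^(r − 1) from the power mean inequality, and the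
  -- last d from bounding each ‖g_i‖_p by the sum S.
  set κ : ℝ≥0∞ := 2 ^ d * ((d : ℝ≥0∞) ^ (r - 1) * d) with hκ
  have hκt : κ ≠ (∞ : ℝ≥0∞) := by
    refine ENNReal.mul_ne_top (by simp) (ENNReal.mul_ne_top ?_ (by simp))
    exact ENNReal.rpow_ne_top_of_nonneg (by linarith) (by simp)
  refine ⟨D * (κ ^ (1 / r)).toNNReal, fun f g hf hg hgp => ?_⟩
  have hκt' : κ ^ (1 / r) ≠ (∞ : ℝ≥0∞) := ENNReal.rpow_ne_top_of_nonneg (by positivity) hκt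
  set S := ∑ i, eLpNorm (g i) p (volume.restrict U) with hS
  have hU0 : volume U ≠ 0 := (hUo.measure_pos volume hUn).ne'
  have : IsFiniteMeasure (volume.restrict U) := ⟨by simpa using hUb.measure_lt_top⟩
  have hsum : ∑ i, ∫⁻ x in U, ‖g i x‖ₑ ^ r ≤ d * S ^ r := by
    calc _ ≤ ∑ i : Fin d, S ^ r := by
          refine Finset.sum_le_sum fun i _ => ?_
          have h1 : eLpNorm (g i) p (volume.restrict U) ≤ S :=
            Finset.single_le_sum (f := fun i => eLpNorm (g i) p (volume.restrict U))
              (fun _ _ => zero_le) (Finset.mem_univ i)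
          calc _ = eLpNorm (g i) p (volume.restrict U) ^ r := by
                rw [eLpNorm_eq_lintegral_rpow_enorm_toReal hp0 hpt, ← ENNReal.rpow_mul,
                  one_div_mul_cancel hr0.ne', ENNReal.rpow_one]
            _ ≤ _ := by gcongr
      _ = _ := by simp
  have hm : AEMeasurable (fun z : E d × E d => ‖f z.1 - f z.2‖ₑ ^ r)
      ((volume.restrict U).prod (volume.restrict U)) :=
    ((hf.1.comp_fst.sub hf.1.comp_snd).enorm).pow_const r
  have hB := (lintegral_prod_sub_rpow_le_of_hasWeakPartial hUo hUc hD
    (locallyIntegrable_indicator_of_memLp hUo hUb hp hf) hg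
    (fun i => locallyIntegrable_indicator_of_memLp hUo hUb hp (hgp i)) hr)
  rw [lintegral_prod_symm _ hm] at hB
  -- Some y makes the inner integral at most its average over U; dividing by |U| cancels the volume
  -- in `hB`.
  obtain ⟨y, hy⟩ := exists_le_laverage (μ := volume.restrict U)
    (by rwa [Ne, Measure.restrict_eq_zero]) hm.lintegral_prod_left'
  refine ⟨f y, ?_⟩
  have hfin : ∫⁻ x in U, ‖f x - f y‖ₑ ^ r ≤ (D : ℝ≥0∞) ^ r * κ * S ^ r := by
    refine hy.trans ?_
    rw [laverage_eq, Measure.restrict_apply_univ]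
    refine ENNReal.div_le_of_le_mul (hB.trans ?_)
    calc _ ≤ (D : ℝ≥0∞) ^ r * (2 ^ d * volume U * ((d : ℝ≥0∞) ^ (r - 1) * (d * S ^ r))) := by
          gcongr
      _ = _ := by rw [hκ]; ring
  rw [eLpNorm_eq_lintegral_rpow_enorm_toReal hp0 hpt, ← hrdef]
  calc _ ≤ ((D : ℝ≥0∞) ^ r * κ * S ^ r) ^ (1 / r) := by gcongr
    _ = _ := by
      rw [ENNReal.mul_rpow_of_nonneg _ _ (by positivity),
        ENNReal.mul_rpow_of_nonneg _ _ (by positivity), ← ENNReal.rpow_mul, ← ENNReal.rpow_mul,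
        mul_one_div_cancel hr0.ne', ENNReal.rpow_one, ENNReal.rpow_one, ENNReal.coe_mul,
        ENNReal.coe_toNNReal hκt']

end Poincare

/-! ### Weak derivatives under affine changes of variables -/

section Affine

variable {d : ℕ}

/-- The linear part of an affine equivalence. -/
def linPart (F : E d ≃ᴬ[ℝ] E d) : E d →L[ℝ] E d := F.toContinuousAffineMap.contLinear

theorem linPart_apply_sub (F : E d ≃ᴬ[ℝ] E d) (x y : E d) : linPart F (x - y) = F x - F y :=
  F.toContinuousAffineMap.toAffineMap.linearMap_vsub x y

theorem apply_eq_linPart_add (F : E d ≃ᴬ[ℝ] E d) (x : E d) : F x = linPart F x + F 0 := by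
  have := linPart_apply_sub F x 0
  rw [sub_zero] at this
  rw [this, sub_add_cancel]

theorem hasFDerivAt_affine (F : E d ≃ᴬ[ℝ] E d) (x : E d) : HasFDerivAt F (linPart F) x := by
  have h : (F : E d → E d) = fun x => linPart F x + F 0 := funext (apply_eq_linPart_add F)
  rw [h]
  exact (linPart F).hasFDerivAt.add_const _

theorem contDiff_affine (F : E d ≃ᴬ[ℝ] E d) : ContDiff ℝ ∞ F := by
  have h : (F : E d → E d) = fun x => linPart F x + F 0 := funext (apply_eq_linPart_add F)
  rw [h]
  exact (linPart F).contDiff.add contDiff_const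

/-- The factor is the reciprocal of the Jacobian. It is left unspecified because it is later
eliminated through the volumes. -/
theorem exists_map_volume_eq_smul (F : E d ≃ᴬ[ℝ] E d) :
    ∃ c : ℝ≥0∞, c ≠ 0 ∧ c ≠ (⊤ : ℝ≥0∞) ∧ Measure.map F volume = c • (volume : Measure (E d)) := by
  have hdet : LinearMap.det F.toAffineEquiv.linear.toLinearMap ≠ 0 :=
    (LinearEquiv.isUnit_det' F.toAffineEquiv.linear).ne_zero
  refine ⟨ENNReal.ofReal |(LinearMap.det F.toAffineEquiv.linear.toLinearMap)⁻¹|, ?_,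
    ENNReal.ofReal_ne_top, ?_⟩
  · simpa using hdet
  have h : (F : E d → E d) = (fun y => y + F 0) ∘ F.toAffineEquiv.linear.toLinearMap :=
    funext (apply_eq_linPart_add F)
  rw [h, ← Measure.map_map (measurable_add_const _)
    (LinearMap.continuous_of_finiteDimensional _).measurable,
    Measure.map_linearMap_addHaar_eq_smul_addHaar _ hdet, Measure.map_smul, map_add_right_eq_self]

theorem measurableEmbedding_affine (F : E d ≃ᴬ[ℝ] E d) : MeasurableEmbedding F :=
  F.toHomeomorph.measurableEmbedding

variable {F : E d ≃ᴬ[ℝ] E d} {c : ℝ≥0∞}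

theorem map_restrict_preimage (hc : Measure.map F volume = c • (volume : Measure (E d)))
    (K : Set (E d)) :
    Measure.map F (volume.restrict (F ⁻¹' K)) = c • volume.restrict K := by
  rw [← (measurableEmbedding_affine F).restrict_map, hc, Measure.restrict_smul]

theorem volume_preimage_affine (hc : Measure.map F volume = c • (volume : Measure (E d)))
    (K : Set (E d)) : volume (F ⁻¹' K) = c * volume K := by
  rw [← (measurableEmbedding_affine F).map_apply, hc]; rfl

theorem normLp_comp_affine (hc : Measure.map F volume = c • (volume : Measure (E d)))
    (hc0 : c ≠ 0) (K : Set (E d)) (p : ℝ≥0∞) (u : E d → ℝ) :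
    normLp (F ⁻¹' K) p (u ∘ F) = c ^ p⁻¹.toReal * normLp K p u := by
  rw [normLp, ← (measurableEmbedding_affine F).eLpNorm_map_measure, map_restrict_preimage hc,
    eLpNorm_smul_measure_of_ne_zero hc0, one_div, smul_eq_mul, normLp]

theorem memLp_comp_affine {K : Set (E d)} {p : ℝ≥0∞} {u : E d → ℝ}
    (hu : MemLp u p (volume.restrict K)) : MemLp (u ∘ F) p (volume.restrict (F ⁻¹' K)) := by
  obtain ⟨c, -, hct, hc⟩ := exists_map_volume_eq_smul F
  rw [← (measurableEmbedding_affine F).memLp_map_measure_iff, map_restrict_preimage hc]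
  exact hu.smul_measure hct

theorem integral_comp_affine (hc : Measure.map F volume = c • (volume : Measure (E d)))
    (u : E d → ℝ) : ∫ x, u (F x) = c.toReal * ∫ x, u x := by
  rw [← (measurableEmbedding_affine F).integral_map, hc, integral_smul_measure, smul_eq_mul]

theorem locallyIntegrableOn_comp_affine {U : Set (E d)} {u : E d → ℝ}
    (hu : LocallyIntegrableOn u U) : LocallyIntegrableOn (u ∘ F) (F ⁻¹' U) := by
  obtain ⟨c, -, hct, hc⟩ := exists_map_volume_eq_smul F
  intro x hx
  obtain ⟨s, hs, hus⟩ := hu (F x) hx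
  refine ⟨F ⁻¹' s, ?_, ?_⟩
  · exact (F.continuous.continuousWithinAt.tendsto_nhdsWithin (Set.mapsTo_preimage F U)) hs
  · rw [IntegrableOn, ← (measurableEmbedding_affine F).integrable_map_iff,
      map_restrict_preimage hc]
    exact Integrable.smul_measure hus hct

theorem integrable_mul_of_locallyIntegrableOn {U : Set (E d)} {u ψ : E d → ℝ}
    (hu : LocallyIntegrableOn u U) (hψ : Continuous ψ) (hψc : HasCompactSupport ψ)
    (hψU : tsupport ψ ⊆ U) : Integrable fun x => u x * ψ x := by
  have h := (hu.integrableOn_compact_subset hψU hψc).mul_continuousOn hψ.continuousOn hψc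
  refine (integrableOn_iff_integrable_of_support_subset fun x hx => ?_).1 h
  exact subset_tsupport ψ fun h0 => hx (by simp [h0])

theorem integral_mul_fderiv_eq {U : Set (E d)} {f : E d → ℝ} {g : Fin d → E d → ℝ}
    (hg : ∀ i, HasWeakPartial U i f (g i)) (v : E d) {ψ : E d → ℝ} (hψ : ContDiff ℝ ∞ ψ)
    (hψc : HasCompactSupport ψ) (hψU : tsupport ψ ⊆ U) :
    ∫ x, f x * fderiv ℝ ψ x v = -∫ x, (∑ i, v i * g i x) * ψ x := by
  have hv : v = ∑ i, v i • (EuclideanSpace.single i 1 : E d) := by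
    ext j; simp [Pi.single_apply]
  have hint1 : ∀ i, Integrable fun x => f x * fderiv ℝ ψ x (EuclideanSpace.single i 1) := by
    intro i
    have hs : tsupport (fun x => fderiv ℝ ψ x (EuclideanSpace.single i 1)) ⊆ tsupport ψ :=
      tsupport_fderiv_apply_subset ℝ _
    exact integrable_mul_of_locallyIntegrableOn (hg i).1
      (((hψ.continuous_fderiv (by simp)).clm_apply continuous_const))
      (hψc.of_isClosed_subset (isClosed_tsupport _) hs) (hs.trans hψU)
  have hint2 : ∀ i, Integrable fun x => g i x * ψ x := fun i =>
    integrable_mul_of_locallyIntegrableOn (hg i).2.1 hψ.continuous hψc hψU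
  calc ∫ x, f x * fderiv ℝ ψ x v
      = ∫ x, ∑ i, v i * (f x * fderiv ℝ ψ x (EuclideanSpace.single i 1)) := by
        congr 1; ext x
        conv_lhs => rw [hv, map_sum, Finset.mul_sum]
        refine Finset.sum_congr rfl fun i _ => ?_
        rw [map_smul, smul_eq_mul]; ring
    _ = ∑ i, v i * ∫ x, f x * fderiv ℝ ψ x (EuclideanSpace.single i 1) := by
        rw [integral_finsetSum _ fun i _ => (hint1 i).const_mul _]
        simp_rw [integral_const_mul]
    _ = -∑ i, v i * ∫ x, g i x * ψ x := by
        rw [← Finset.sum_neg_distrib]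
        refine Finset.sum_congr rfl fun i _ => ?_
        rw [(hg i).2.2 ψ hψ hψc hψU, mul_neg]
    _ = -∫ x, ∑ i, v i * (g i x * ψ x) := by
        rw [integral_finsetSum _ fun i _ => (hint2 i).const_mul _]
        simp_rw [integral_const_mul]
    _ = _ := by
        congr 2; ext x
        rw [Finset.sum_mul]
        exact Finset.sum_congr rfl fun i _ => by ring

theorem hasWeakPartial_comp_affine {U : Set (E d)} {f : E d → ℝ} {g : Fin d → E d → ℝ}
    (hg : ∀ i, HasWeakPartial U i f (g i)) (k : Fin d) :
    HasWeakPartial (F ⁻¹' U) k (f ∘ F)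
      ((fun x => ∑ i, linPart F (EuclideanSpace.single k 1) i * g i x) ∘ F) := by
  obtain ⟨c, -, hct, hc⟩ := exists_map_volume_eq_smul F
  refine ⟨locallyIntegrableOn_comp_affine (hg k).1, locallyIntegrableOn_comp_affine ?_, ?_⟩
  · intro x hx
    choose s hs hus using fun i => (hg i).2.1 x hx
    refine ⟨⋂ i, s i, Filter.iInter_mem.2 hs, ?_⟩
    exact integrable_finsetSum _ fun i _ =>
      ((hus i).mono_set (Set.iInter_subset s i)).const_mul _
  intro ψ hψ hψc hψU
  -- Moving the test function to the image side lets the same Jacobian factor come out of both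
  -- integrals.
  set ψ' : E d → ℝ := ψ ∘ F.symm with hψ'
  have hψ'F : ∀ x, ψ' (F x) = ψ x := fun x => by simp [hψ']
  have hψ'd : ContDiff ℝ ∞ ψ' := hψ.comp (contDiff_affine F.symm)
  have hψ'c : HasCompactSupport ψ' := hψc.comp_homeomorph F.symm.toHomeomorph
  have hψ'U : tsupport ψ' ⊆ U := by
    have h : tsupport ψ' = F.symm ⁻¹' tsupport ψ :=
      tsupport_comp_eq_preimage ψ F.symm.toHomeomorph
    rw [h]
    intro y hy
    have := hψU hy
    simpa using this
  have hfd : ∀ x, fderiv ℝ ψ x (EuclideanSpace.single k 1) =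
      fderiv ℝ ψ' (F x) (linPart F (EuclideanSpace.single k 1)) := fun x => by
    have h1 := ((hψ'd.differentiable (by simp) (F x)).hasFDerivAt.comp x
      (hasFDerivAt_affine F x)).fderiv
    have h2 : ψ' ∘ F = ψ := funext hψ'F
    rw [h2] at h1
    rw [h1]; rfl
  simp_rw [hfd, Function.comp_apply, ← hψ'F]
  rw [integral_comp_affine hc (fun y => f y * fderiv ℝ ψ' y (linPart F _)),
    integral_comp_affine hc (fun y => (∑ i, linPart F (EuclideanSpace.single k 1) i * g i y) * ψ' y),
    integral_mul_fderiv_eq hg _ hψ'd hψ'c hψ'U, mul_neg]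

end Affine

/-! ### Sobolev norms on convex sets -/

section Sobolev

variable {d : ℕ}

/-- The boundary of a convex set is null. This reconciles derivatives, taken on the interior, with
norms, taken on K. -/
theorem restrict_interior_eq {K : Set (E d)} (hK : Convex ℝ K) :
    volume.restrict (interior K) = volume.restrict K := by
  refine Measure.restrict_congr_set (interior_ae_eq_of_null_frontier ?_)
  exact hK.addHaar_frontier volume

/-- By the fundamental lemma of the calculus of variations; hence the choice made in `weakPartial`
is harmless. -/
theorem HasWeakPartial.ae_eq {U : Set (E d)} (hU : IsOpen U) {i : Fin d} {f g g' : E d → ℝ}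
    (h : HasWeakPartial U i f g) (h' : HasWeakPartial U i f g') :
    g =ᵐ[volume.restrict U] g' := by
  have hae := hU.ae_eq_zero_of_integral_contDiff_smul_eq_zero (f := g - g') (μ := volume)
    (h.2.1.sub h'.2.1) fun ψ hψ hψc hψU => by
      have h1 := integrable_mul_of_locallyIntegrableOn h.2.1 hψ.continuous hψc hψU
      have h2 := integrable_mul_of_locallyIntegrableOn h'.2.1 hψ.continuous hψc hψU
      have e1 := h.2.2 ψ hψ hψc hψU
      have e2 := h'.2.2 ψ hψ hψc hψU
      calc ∫ x, ψ x • (g - g') x = ∫ x, (g x * ψ x - g' x * ψ x) := by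
            congr 1; ext x; simp; ring
        _ = 0 := by rw [integral_sub h1 h2]; linarith
  rw [Filter.EventuallyEq, ae_restrict_iff' hU.measurableSet]
  filter_upwards [hae] with x hx hxU
  have := hx hxU
  rw [Pi.sub_apply] at this
  linarith

theorem HasWeakPartial.weakPartial {K : Set (E d)} {i : Fin d} {f g : E d → ℝ}
    (h : HasWeakPartial (interior K) i f g) :
    HasWeakPartial (interior K) i f (weakPartial K i f) := by
  have hex : ∃ g, HasWeakPartial (interior K) i f g := ⟨g, h⟩
  rw [AnisotropicMean.weakPartial, dif_pos hex]
  exact hex.choose_spec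

theorem HasWeakPartial.weakPartial_ae_eq {K : Set (E d)} (hK : Convex ℝ K) {i : Fin d}
    {f g : E d → ℝ} (h : HasWeakPartial (interior K) i f g) :
    AnisotropicMean.weakPartial K i f =ᵐ[volume.restrict K] g := by
  rw [← restrict_interior_eq hK]
  exact h.weakPartial.ae_eq isOpen_interior h

theorem MemW1.hasWeakPartial {K : Set (E d)} {p : ℝ≥0∞} {f : E d → ℝ} (hf : MemW1 K p f)
    (i : Fin d) : HasWeakPartial (interior K) i f (weakPartial K i f) := by
  obtain ⟨g, hg, -⟩ := hf.2 i
  exact hg.weakPartial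

theorem MemW1.memLp_weakPartial {K : Set (E d)} (hK : Convex ℝ K) {p : ℝ≥0∞} {f : E d → ℝ}
    (hf : MemW1 K p f) (i : Fin d) : MemLp (weakPartial K i f) p (volume.restrict K) := by
  obtain ⟨g, hg, hgp⟩ := hf.2 i
  exact hgp.ae_eq (hg.weakPartial_ae_eq hK).symm

theorem interior_preimage_affine (F : E d ≃ᴬ[ℝ] E d) (K : Set (E d)) :
    interior (F ⁻¹' K) = F ⁻¹' interior K :=
  (F.toHomeomorph.preimage_interior K).symm

theorem convex_preimage_affine (F : E d ≃ᴬ[ℝ] E d) {K : Set (E d)} (hK : Convex ℝ K) :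
    Convex ℝ (F ⁻¹' K) := hK.affine_preimage F.toAffineEquiv.toAffineMap

theorem MemW1.hasWeakPartial_comp {K : Set (E d)} {p : ℝ≥0∞} {f : E d → ℝ} (hf : MemW1 K p f)
    (F : E d ≃ᴬ[ℝ] E d) (k : Fin d) :
    HasWeakPartial (interior (F ⁻¹' K)) k (f ∘ F)
      (weakDirDeriv K (linPart F (EuclideanSpace.single k 1)) f ∘ F) := by
  rw [interior_preimage_affine]
  exact hasWeakPartial_comp_affine hf.hasWeakPartial k

theorem MemW1.memLp_weakDirDeriv {K : Set (E d)} (hK : Convex ℝ K) {p : ℝ≥0∞} {f : E d → ℝ}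
    (hf : MemW1 K p f) (v : E d) : MemLp (weakDirDeriv K v f) p (volume.restrict K) :=
  memLp_finsetSum _ fun i _ => (hf.memLp_weakPartial hK i).const_mul (v i)

theorem MemW1.comp_affine {K : Set (E d)} (hK : Convex ℝ K) {p : ℝ≥0∞} {f : E d → ℝ}
    (hf : MemW1 K p f) (F : E d ≃ᴬ[ℝ] E d) : MemW1 (F ⁻¹' K) p (f ∘ F) :=
  ⟨memLp_comp_affine hf.1, fun k => ⟨_, hf.hasWeakPartial_comp F k,
    memLp_comp_affine (hf.memLp_weakDirDeriv hK _)⟩⟩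

theorem MemW1.weakPartial_comp_ae_eq {K : Set (E d)} (hK : Convex ℝ K) {p : ℝ≥0∞} {f : E d → ℝ}
    (hf : MemW1 K p f) (F : E d ≃ᴬ[ℝ] E d) (k : Fin d) :
    weakPartial (F ⁻¹' K) k (f ∘ F) =ᵐ[volume.restrict (F ⁻¹' K)]
      weakDirDeriv K (linPart F (EuclideanSpace.single k 1)) f ∘ F :=
  (hf.hasWeakPartial_comp F k).weakPartial_ae_eq (convex_preimage_affine F hK)

theorem MemW1.normLp_weakDirDeriv_le {K : Set (E d)} (hK : Convex ℝ K) {p : ℝ≥0∞} (hp : 1 ≤ p)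
    {f : E d → ℝ} (hf : MemW1 K p f) (v : E d) :
    normLp K p (weakDirDeriv K v f) ≤ ∑ i, ‖v i‖ₑ * normLp K p (weakPartial K i f) := by
  have e : weakDirDeriv K v f = ∑ i, v i • weakPartial K i f := by
    ext x; simp [weakDirDeriv]
  rw [normLp, e]
  refine (eLpNorm_sum_le (fun i _ => ((hf.memLp_weakPartial hK i).1.const_smul _)) hp).trans ?_
  refine Finset.sum_le_sum fun i _ => ?_
  rw [eLpNorm_const_smul, normLp]

theorem MemW1.normLp_weakPartial_comp {K : Set (E d)} (hK : Convex ℝ K) {p : ℝ≥0∞}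
    {f : E d → ℝ} (hf : MemW1 K p f) {F : E d ≃ᴬ[ℝ] E d} {c : ℝ≥0∞}
    (hc : Measure.map F volume = c • (volume : Measure (E d))) (hc0 : c ≠ 0) (k : Fin d) :
    normLp (F ⁻¹' K) p (weakPartial (F ⁻¹' K) k (f ∘ F)) =
      c ^ p⁻¹.toReal * normLp K p (weakDirDeriv K (linPart F (EuclideanSpace.single k 1)) f) := by
  rw [normLp, eLpNorm_congr_ae (hf.weakPartial_comp_ae_eq hK F k), ← normLp_comp_affine hc hc0]
  rfl

theorem exists_normW1_comp_le {K : Set (E d)} (hK : Convex ℝ K) {p : ℝ≥0∞} (hp : 1 ≤ p)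
    (F : E d ≃ᴬ[ℝ] E d) :
    ∃ C : ℝ≥0, ∀ f, MemW1 K p f → normW1 (F ⁻¹' K) p (f ∘ F) ≤ C * normW1 K p f := by
  obtain ⟨c, hc0, hct, hc⟩ := exists_map_volume_eq_smul F
  have hcp : c ^ p⁻¹.toReal ≠ (⊤ : ℝ≥0∞) :=
    ENNReal.rpow_ne_top_of_nonneg ENNReal.toReal_nonneg hct
  set m : ℝ≥0 := ∑ k, ‖linPart F (EuclideanSpace.single k (1 : ℝ))‖₊ with hm
  refine ⟨(c ^ p⁻¹.toReal).toNNReal * (1 + m), fun f hf => ?_⟩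
  rw [ENNReal.coe_mul, ENNReal.coe_toNNReal hcp, mul_assoc, normW1, normLp_comp_affine hc hc0]
  simp_rw [hf.normLp_weakPartial_comp hK hc hc0]
  rw [← Finset.mul_sum, ← mul_add]
  gcongr
  rw [ENNReal.coe_add, ENNReal.coe_one, add_mul, one_mul]
  gcongr
  · exact le_self_add
  rw [hm, ENNReal.ofNNReal_finsetSum, Finset.sum_mul]
  refine Finset.sum_le_sum fun k _ => (hf.normLp_weakDirDeriv_le hK hp _).trans ?_
  calc _ ≤ ∑ i, ‖linPart F (EuclideanSpace.single k (1 : ℝ))‖ₑ *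
        normLp K p (weakPartial K i f) := by
        gcongr with i
        rw [enorm_le_iff_norm_le]
        exact PiLp.norm_apply_le _ i
    _ ≤ _ := by
        rw [← Finset.mul_sum, normW1]
        gcongr
        · exact le_rfl
        · exact le_add_self

theorem W1EmbedsLp.preimage_affine {K : Set (E d)} (hK : Convex ℝ K) {p q : ℝ≥0∞} (hp : 1 ≤ p)
    (h : W1EmbedsLp K p q) (F : E d ≃ᴬ[ℝ] E d) : W1EmbedsLp (F ⁻¹' K) p q := by
  obtain ⟨c, hc0, hct, hc⟩ := exists_map_volume_eq_smul F
  have hcq : c ^ q⁻¹.toReal ≠ (⊤ : ℝ≥0∞) :=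
    ENNReal.rpow_ne_top_of_nonneg ENNReal.toReal_nonneg hct
  have hKF := convex_preimage_affine F hK
  obtain ⟨C, hC⟩ := h
  obtain ⟨C', hC'⟩ := exists_normW1_comp_le hKF hp F.symm
  have hpre : F.symm ⁻¹' (F ⁻¹' K) = K := by ext; simp
  refine ⟨(c ^ q⁻¹.toReal).toNNReal * (C * C'), fun f hf => ?_⟩
  have hf' := hf.comp_affine hKF F.symm
  have hff : (f ∘ F.symm) ∘ F = f := by ext; simp
  have hn := hC' f hf
  rw [hpre] at hf' hn
  obtain ⟨h1, h2⟩ := hC _ hf'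
  constructor
  · have := memLp_comp_affine (F := F) h1
    rwa [hff] at this
  · have := normLp_comp_affine hc hc0 K q (f ∘ F.symm)
    rw [hff] at this
    rw [this, ENNReal.coe_mul, ENNReal.coe_toNNReal hcq, mul_assoc, ENNReal.coe_mul, mul_assoc]
    gcongr
    exact h2.trans (by gcongr)

/-! ### The mean value on an affine image -/

theorem HasWeakPartial.sub_const {U : Set (E d)} {i : Fin d} {f g : E d → ℝ}
    (h : HasWeakPartial U i f g) (a : ℝ) : HasWeakPartial U i (fun x => f x - a) g := by
  refine ⟨h.1.sub ((locallyIntegrable_const a).locallyIntegrableOn U), h.2.1,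
    fun ψ hψ hψc hψU => ?_⟩
  have hd : Continuous fun x => fderiv ℝ ψ x (EuclideanSpace.single i 1) :=
    (hψ.continuous_fderiv (by simp)).clm_apply continuous_const
  have hdc : HasCompactSupport fun x => fderiv ℝ ψ x (EuclideanSpace.single i 1) :=
    hψc.fderiv_apply ℝ _
  have h1 := integrable_mul_of_locallyIntegrableOn h.1 hd hdc
    ((tsupport_fderiv_apply_subset ℝ _).trans hψU)
  have h2 : Integrable fun x => fderiv ℝ ψ x (EuclideanSpace.single i 1) :=
    hd.integrable_of_hasCompactSupport hdc
  -- Integration by parts against the constant 1.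
  have h3 : ∫ x, fderiv ℝ ψ x (EuclideanSpace.single i 1) = 0 := by
    have hψi : Integrable ψ := hψ.continuous.integrable_of_hasCompactSupport hψc
    have := integral_mul_fderiv_eq_neg_fderiv_mul_of_integrable (𝕜 := ℝ) (μ := volume)
      (f := fun _ : E d => (1 : ℝ)) (g := ψ) (v := EuclideanSpace.single i 1) (by simp)
      (by simpa using h2) (by simpa using hψi) (by fun_prop)
      fun x _ => hψ.differentiable (by simp) x
    simpa using this
  rw [← h.2.2 ψ hψ hψc hψU]
  simp_rw [sub_mul]
  rw [integral_sub h1 (h2.const_mul a), integral_const_mul, h3, mul_zero, sub_zero]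

/-- The mean value reproduces constants, so mean f − f = mean (f − a) − (f − a), and Hölder bounds
the first term. -/
theorem exists_normLp_meanProj_sub_le_sub_const {K : Set (E d)} (hKc : IsCompact K)
    (hK0 : volume K ≠ 0) {q : ℝ≥0∞} (hq : 1 ≤ q) :
    ∃ C : ℝ≥0, ∀ (f : E d → ℝ) (a : ℝ), MemLp f q (volume.restrict K) →
      normLp K q (fun x => meanProj K f - f x) ≤ C * normLp K q (fun x => f x - a) := by
  have hKt : volume K ≠ (⊤ : ℝ≥0∞) := hKc.measure_lt_top.ne
  have hfin : IsFiniteMeasure (volume.restrict K) := ⟨by simpa using hKc.measure_lt_top⟩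
  have hne : volume.restrict K ≠ 0 := by rwa [Ne, Measure.restrict_eq_zero]
  set κ : ℝ≥0∞ := (volume K)⁻¹ * volume K ^ (1 / (1 : ℝ≥0∞).toReal - 1 / q.toReal) *
    volume K ^ (1 / q.toReal) with hκ
  have hκt : κ ≠ (⊤ : ℝ≥0∞) := ENNReal.mul_ne_top (ENNReal.mul_ne_top (by simpa using hK0)
    (ENNReal.rpow_ne_top_of_ne_zero hK0 hKt)) (ENNReal.rpow_ne_top_of_ne_zero hK0 hKt)
  refine ⟨κ.toNNReal + 1, fun f a hf => ?_⟩
  have hfa : MemLp (fun x => f x - a) q (volume.restrict K) := hf.sub (memLp_const a)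
  have hmean : meanProj K f - a = ⨍ x in K, (f x - a) := by
    rw [meanProj, average_eq, average_eq, integral_sub (hf.integrable hq) (integrable_const a),
      smul_sub]
    have hr : volume.real K ≠ 0 := (ENNReal.toReal_pos hK0 hKt).ne'
    rw [integral_const, smul_eq_mul, measureReal_restrict_apply_univ, smul_eq_mul, smul_eq_mul,
      inv_mul_cancel_left₀ hr]
  have hm : ‖meanProj K f - a‖ₑ ≤ (volume K)⁻¹ *
      (normLp K q (fun x => f x - a) *
        volume K ^ (1 / (1 : ℝ≥0∞).toReal - 1 / q.toReal)) := by
    have h1 := eLpNorm_le_eLpNorm_mul_rpow_measure_univ hq hfa.1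
    rw [Measure.restrict_apply_univ, eLpNorm_one_eq_lintegral_enorm] at h1
    rw [hmean, average_eq']
    refine (enorm_integral_le_lintegral_enorm _).trans ?_
    rw [lintegral_smul_measure, Measure.restrict_apply_univ, smul_eq_mul]
    gcongr
    exact h1
  have hsplit : (fun x => meanProj K f - f x) =
      (fun _ => meanProj K f - a) - fun x => f x - a := by
    ext x; simp
  rw [normLp, hsplit]
  refine (eLpNorm_sub_le aestronglyMeasurable_const hfa.1 hq).trans ?_
  rw [ENNReal.coe_add, ENNReal.coe_toNNReal hκt, add_mul, ENNReal.coe_one, one_mul]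
  refine add_le_add ?_ le_rfl
  rw [eLpNorm_const _ (one_pos.trans_le hq).ne' hne, Measure.restrict_apply_univ]
  refine (mul_le_mul_left hm _).trans (le_of_eq ?_)
  rw [hκ]; ring

theorem exists_normLp_meanProj_sub_le {K : Set (E d)} (hK : Convex ℝ K) (hKc : IsCompact K)
    (hKi : (interior K).Nonempty) {p q : ℝ≥0∞} (hp : 1 ≤ p) (hq : 1 ≤ q)
    (h : W1EmbedsLp K p q) :
    ∃ C : ℝ≥0, ∀ f, MemW1 K p f → normLp K q (fun x => meanProj K f - f x) ≤
      C * ∑ i, normLp K p (weakPartial K i f) := by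
  obtain ⟨C₁, hC₁⟩ := exists_poincare isOpen_interior hK.interior
    (hKc.isBounded.subset interior_subset) hKi hp
  obtain ⟨C₂, hC₂⟩ := h
  have hK0 : volume K ≠ 0 := fun h0 =>
    (isOpen_interior.measure_pos volume hKi).ne' (measure_mono_null interior_subset h0)
  have hfin : IsFiniteMeasure (volume.restrict K) := ⟨by simpa using hKc.measure_lt_top⟩
  obtain ⟨C₃, hC₃⟩ := exists_normLp_meanProj_sub_le_sub_const hKc hK0 hq
  refine ⟨C₃ * (C₂ * (C₁ + 1)), fun f hf => ?_⟩
  obtain ⟨a, ha⟩ := hC₁ f (fun i => weakPartial K i f)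
    (by rw [restrict_interior_eq hK]; exact hf.1) hf.hasWeakPartial
    (by rw [restrict_interior_eq hK]; exact hf.memLp_weakPartial hK)
  rw [restrict_interior_eq hK] at ha
  have hfa : MemW1 K p (fun x => f x - a) := ⟨hf.1.sub (memLp_const a), fun i =>
    ⟨_, (hf.hasWeakPartial i).sub_const a, hf.memLp_weakPartial hK i⟩⟩
  have hnorm : normW1 K p (fun x => f x - a) ≤
      (C₁ + 1) * ∑ i, normLp K p (weakPartial K i f) := by
    rw [normW1, add_mul, one_mul]
    refine add_le_add ha (le_of_eq (Finset.sum_congr rfl fun i _ => ?_))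
    exact eLpNorm_congr_ae (((hf.hasWeakPartial i).sub_const a).weakPartial_ae_eq hK)
  refine (hC₃ f a (hC₂ f hf).1).trans ?_
  rw [ENNReal.coe_mul, ENNReal.coe_mul, mul_assoc, mul_assoc]
  gcongr
  refine (hC₂ _ hfa).2.trans ?_
  gcongr
  exact hnorm

theorem meanProj_comp_affine {F : E d ≃ᴬ[ℝ] E d} {c : ℝ≥0∞}
    (hc : Measure.map F volume = c • (volume : Measure (E d))) (hc0 : c ≠ 0)
    (hct : c ≠ (⊤ : ℝ≥0∞)) (K : Set (E d)) (f : E d → ℝ) :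
    meanProj (F ⁻¹' K) (f ∘ F) = meanProj K f := by
  have hcr : c.toReal ≠ 0 := (ENNReal.toReal_pos hc0 hct).ne'
  have h : ∫ x in F ⁻¹' K, (f ∘ F) x = c.toReal * ∫ x in K, f x := by
    rw [← smul_eq_mul, ← integral_smul_measure, ← map_restrict_preimage hc,
      (measurableEmbedding_affine F).integral_map]
    rfl
  rw [meanProj, meanProj, setAverage_eq, setAverage_eq, h, Measure.real,
    volume_preimage_affine hc, ENNReal.toReal_mul, Measure.real, smul_eq_mul, smul_eq_mul,
    mul_inv, mul_mul_mul_comm, inv_mul_cancel₀ hcr, one_mul]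

/-- The constant is chosen before F and K', which gives uniformity over all elements with the same
reference element. -/
theorem exists_normLp_meanProj_sub_le_affine {K : Set (E d)} (hK : Convex ℝ K)
    (hKc : IsCompact K) (hKi : (interior K).Nonempty) {p q : ℝ≥0∞} (hp : 1 ≤ p) (hq : 1 ≤ q) :
    ∃ C : ℝ≥0, ∀ (F : E d ≃ᴬ[ℝ] E d) (K' : Set (E d)), F ⁻¹' K' = K → W1EmbedsLp K' p q →
      ∀ f, MemW1 K p (f ∘ F) →
        normLp K' q (fun x => meanProj K' f - f x) ≤
          C * volume K' ^ (q⁻¹.toReal - p⁻¹.toReal) *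
            ∑ i, normLp K' p (weakDirDeriv K' (linPart F (EuclideanSpace.single i 1)) f) := by
  -- Without the embedding on K no affine image K' has it either, so any constant will do.
  by_cases h : W1EmbedsLp K p q
  swap
  · refine ⟨0, fun F K' hKK' hemb => (h ?_).elim⟩
    have hK' : Convex ℝ K' := by
      have := convex_preimage_affine F.symm hK
      rw [← hKK'] at this
      rwa [show F.symm ⁻¹' (F ⁻¹' K') = K' by ext; simp] at this
    rw [← hKK']
    exact hemb.preimage_affine hK' hp F
  obtain ⟨C, hC⟩ := exists_normLp_meanProj_sub_le hK hKc hKi hp hq h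
  have hK0 : volume K ≠ 0 := fun h0 =>
    (isOpen_interior.measure_pos volume hKi).ne' (measure_mono_null interior_subset h0)
  have hKt : volume K ≠ (⊤ : ℝ≥0∞) := hKc.measure_lt_top.ne
  have hκt : volume K ^ (p⁻¹.toReal - q⁻¹.toReal) ≠ (⊤ : ℝ≥0∞) :=
    ENNReal.rpow_ne_top_of_ne_zero hK0 hKt
  refine ⟨C * (volume K ^ (p⁻¹.toReal - q⁻¹.toReal)).toNNReal, fun F K' hKK' _ f hf => ?_⟩
  have hK' : Convex ℝ K' := by
    have := convex_preimage_affine F.symm hK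
    rw [← hKK'] at this
    rwa [show F.symm ⁻¹' (F ⁻¹' K') = K' by ext; simp] at this
  have hf' : MemW1 K' p f := by
    have h1 := hf.comp_affine hK F.symm
    have h2 : (f ∘ F) ∘ F.symm = f := by ext; simp
    have h3 : F.symm ⁻¹' K = K' := by rw [← hKK']; ext; simp
    rwa [h2, h3] at h1
  obtain ⟨c, hc0, hct, hc⟩ := exists_map_volume_eq_smul F
  have hmain := hC _ hf
  subst hKK'
  simp_rw [hf'.normLp_weakPartial_comp hK' hc hc0] at hmain
  rw [meanProj_comp_affine hc hc0 hct, ← Finset.mul_sum] at hmain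
  have hl := normLp_comp_affine hc hc0 K' q (fun x => meanProj K' f - f x)
  set S := ∑ i, normLp K' p (weakDirDeriv K' (linPart F (EuclideanSpace.single i 1)) f)
  set N := normLp K' q (fun x => meanProj K' f - f x)
  change normLp (F ⁻¹' K') q ((fun x => meanProj K' f - f x) ∘ F) ≤ _ at hmain
  rw [hl] at hmain
  have hV := volume_preimage_affine hc K'
  have hV0 : volume K' ≠ 0 := fun h0 => hK0 (by rw [hV, h0, mul_zero])
  have hVt : volume K' ≠ (⊤ : ℝ≥0∞) := fun h0 => hKt (by rw [hV, h0, ENNReal.mul_top hc0])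
  rw [ENNReal.coe_mul, ENNReal.coe_toNNReal hκt]
  calc N = c ^ (-q⁻¹.toReal) * (c ^ q⁻¹.toReal * N) := by
        rw [← mul_assoc, ← ENNReal.rpow_add _ _ hc0 hct, neg_add_cancel, ENNReal.rpow_zero,
          one_mul]
    _ ≤ c ^ (-q⁻¹.toReal) * (C * (c ^ p⁻¹.toReal * S)) := by gcongr
    _ = C * c ^ (p⁻¹.toReal - q⁻¹.toReal) * S := by
        rw [sub_eq_neg_add, ENNReal.rpow_add _ _ hc0 hct]; ring
    _ = _ := by
        congr 1
        rw [mul_assoc]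
        congr 1
        -- Since |K| = c |K'|, the power c^(1/p − 1/q) equals |K|^(1/p − 1/q) |K'|^(1/q − 1/p).
        rw [hV, ENNReal.mul_rpow_of_ne_top hct hVt, mul_assoc, ← ENNReal.rpow_add _ _ hV0 hVt]
        simp

end Sobolev

/-! ### The reference elements and the affine maps of an element -/

namespace Shape

/-- Each r_k points along the image of a reference edge equal to e_k; in type (ii) the edge for e_2
starts at the second vertex. -/
theorem exists_edge {d : ℕ} (S : Shape d) (k : Fin d) : ∃ i j : Fin (d + 1),
    S.refVertex i - S.refVertex j = EuclideanSpace.single k 1 ∧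
      ∀ v, S.dir v k = (dist (v i) (v j))⁻¹ • (v i - v j) := by
  cases S with
  | triangle s t =>
    fin_cases k
    · exact ⟨1, 0, by ext l; fin_cases l <;> simp [refVertex], fun v => rfl⟩
    · exact ⟨2, 0, by ext l; fin_cases l <;> simp [refVertex], fun v => rfl⟩
  | tetraI s₁ t₁ s₂₁ s₂₂ t₂ =>
    fin_cases k
    · exact ⟨1, 0, by ext l; fin_cases l <;> simp [refVertex], fun v => rfl⟩
    · exact ⟨2, 0, by ext l; fin_cases l <;> simp [refVertex], fun v => rfl⟩
    · exact ⟨3, 0, by ext l; fin_cases l <;> simp [refVertex], fun v => rfl⟩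
  | tetraII s₁ t₁ s₂₁ s₂₂ t₂ =>
    fin_cases k
    · exact ⟨1, 0, by ext l; fin_cases l <;> simp [refVertex], fun v => rfl⟩
    · exact ⟨2, 1, by ext l; fin_cases l <;> simp [refVertex], fun v => rfl⟩
    · exact ⟨3, 0, by ext l; fin_cases l <;> simp [refVertex], fun v => rfl⟩

theorem convex_refElement {d : ℕ} (S : Shape d) : Convex ℝ S.refElement := convex_convexHull ℝ _

theorem isCompact_refElement {d : ℕ} (S : Shape d) : IsCompact S.refElement :=
  (Set.finite_range _).isCompact_convexHull (𝕜 := ℝ)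

theorem interior_refElement_nonempty {d : ℕ} (S : Shape d) : (interior S.refElement).Nonempty := by
  rw [refElement, interior_convexHull_nonempty_iff_affineSpan_eq_top,
    AffineSubspace.affineSpan_eq_top_iff_vectorSpan_eq_top_of_nonempty ℝ (E d) (E d)
      (Set.range_nonempty _), eq_top_iff]
  intro x _
  have hx : x = ∑ i, x i • (EuclideanSpace.single i 1 : E d) := by
    ext j; simp [Pi.single_apply]
  rw [hx]
  refine Submodule.sum_mem _ fun k _ => Submodule.smul_mem _ _ ?_
  obtain ⟨i, j, hij, -⟩ := S.exists_edge k
  rw [← hij]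
  exact vsub_mem_vectorSpan ℝ (Set.mem_range_self i) (Set.mem_range_self j)

/-- The reference element ignores the shape parameters, so one sample of each kind, here with all
parameters 0, gives the constant. -/
theorem exists_forall_refElement {d : ℕ} (hd : d = 2 ∨ d = 3) (P : Set (E d) → ℝ≥0 → Prop)
    (hmono : ∀ K C C', C ≤ C' → P K C → P K C') (h : ∀ S : Shape d, ∃ C, P S.refElement C) :
    ∃ C, ∀ S : Shape d, P S.refElement C := by
  rcases hd with rfl | rfl
  · obtain ⟨C, hC⟩ := h (triangle 0 0)
    refine ⟨C, fun S => ?_⟩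
    cases S with
    | triangle s t => exact hC
  · obtain ⟨C, hC⟩ := h (tetraI 0 0 0 0 0)
    obtain ⟨C', hC'⟩ := h (tetraII 0 0 0 0 0)
    refine ⟨max C C', fun S => ?_⟩
    cases S with
    | tetraI => exact hmono _ _ _ (le_max_left _ _) hC
    | tetraII => exact hmono _ _ _ (le_max_right _ _) hC'

/-- The admissibility bound on `h 2 * s₂₁` is one-sided and says nothing for negative s₂₁; the
second estimate uses |s₂₁| ≤ 1 and `h20` instead. -/
theorem TetraAdmissible.abs_le {h : Fin 3 → ℝ} {s₁ t₁ s₂₁ s₂₂ t₂ M : ℝ}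
    (hadm : TetraAdmissible h s₁ t₁ s₂₁ s₂₂ t₂) (hpos : ∀ i, 0 < h i) (h20 : h 2 ≤ 2 * h 0)
    (hG : |s₂₂| ≤ M * (h 1 * t₁ / h 2)) :
    |s₁| * |h 1| ≤ 2 * h 0 ∧ |s₂₁| * |h 2| ≤ 2 * h 0 ∧ |s₂₂| * |h 2| ≤ M * (h 1 * t₁) := by
  obtain ⟨-, hs₁, -, hs₁h, hsum, -, -⟩ := hadm
  have h0 := hpos 0
  have h1 := hpos 1
  have h2 := hpos 2
  have hs : |s₂₁| ≤ 1 := abs_le_one_iff_mul_self_le_one.2 (by nlinarith [sq_nonneg s₂₂])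
  rw [abs_of_pos h1, abs_of_pos h2, abs_of_pos hs₁]
  refine ⟨by linarith, by nlinarith, ?_⟩
  calc _ ≤ M * (h 1 * t₁ / h 2) * h 2 := by gcongr
    _ = _ := by field_simp

theorem abs_upperTriangular_mul_le {h : Fin 3 → ℝ} {a b c t₁ t₂ M : ℝ} (hpos : ∀ i, 0 < h i)
    (ht₁ : 0 < t₁) (ht₂ : 0 < t₂) (hM : 0 < M) (ha : |a| * |h 1| ≤ 2 * h 0)
    (hb : |b| * |h 2| ≤ 2 * h 0) (hc : |c| * |h 2| ≤ M * (h 1 * t₁)) (i k : Fin 3) :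
    |(!![1, a, b; 0, t₁, c; 0, 0, t₂] : Matrix (Fin 3) (Fin 3) ℝ) i k * h k| ≤
      (2 + M) * ![h 0, h 1 * t₁, h 2 * t₂] i := by
  have h0 := hpos 0
  have h1 := hpos 1
  have h2 := hpos 2
  have hle : ∀ {x : ℝ}, 0 ≤ x → x ≤ (2 + M) * x := fun hx => by nlinarith
  have h1t : 0 < h 1 * t₁ := by positivity
  have h2t : 0 < h 2 * t₂ := by positivity
  fin_cases i <;> fin_cases k <;> simp [abs_mul]
  · rw [abs_of_pos h0]; exact hle h0.le
  · nlinarith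
  · nlinarith
  · positivity
  · rw [abs_of_pos h1, abs_of_pos ht₁, mul_comm t₁]; exact hle h1t.le
  · nlinarith
  · positivity
  · positivity
  · rw [abs_of_pos h2, abs_of_pos ht₂, mul_comm t₂]; exact hle h2t.le

theorem sum_matrix_sq {d : ℕ} (S : Shape d) {h : Fin d → ℝ} (hS : S.Admissible h) (k : Fin d) :
    ∑ i, S.matrix i k ^ 2 = 1 := by
  cases S with
  | triangle s t => fin_cases k <;> simp [matrix, Fin.sum_univ_two, hS.1]
  | tetraI s₁ t₁ s₂₁ s₂₂ t₂ =>
    obtain ⟨h1, -, -, -, h2, -⟩ := hS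
    fin_cases k <;> simp [matrix, Fin.sum_univ_three, h1, h2]
  | tetraII s₁ t₁ s₂₁ s₂₂ t₂ =>
    obtain ⟨h1, -, -, -, h2, -⟩ := hS
    fin_cases k <;> simp [matrix, Fin.sum_univ_three, h1, h2]

theorem linMap_single_apply {d : ℕ} (S : Shape d) (h : Fin d → ℝ) (i k : Fin d) :
    S.linMap h (EuclideanSpace.single k 1) i = S.matrix i k * h k := by
  simp [linMap, Matrix.mul_diagonal]

theorem norm_linMap_single {d : ℕ} (S : Shape d) {h : Fin d → ℝ} (hS : S.Admissible h)
    {k : Fin d} (hk : 0 < h k) : ‖S.linMap h (EuclideanSpace.single k 1)‖ = h k := by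
  rw [EuclideanSpace.norm_eq]
  simp_rw [linMap_single_apply, norm_mul, mul_pow, Real.norm_eq_abs, sq_abs]
  rw [← Finset.sum_mul, sum_matrix_sq S hS, one_mul, Real.sqrt_sq hk.le]

end Shape

/-! ### The two affine maps of an element and the size of their columns -/

namespace Element

variable {d : ℕ} (T : Element d)

/-- The linear map onto the element in standard position, as an affine equivalence. -/
def linEquiv : E d ≃ᴬ[ℝ] E d :=
  (LinearEquiv.ofInjectiveEndo
    { toFun := T.shape.linMap T.h
      map_add' := fun x y => by simp [Shape.linMap, Matrix.mulVec_add]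
      map_smul' := fun a x => by simp [Shape.linMap, Matrix.mulVec_smul] }
    (Function.Injective.of_comp (f := T.rigid)
      T.toMap_bijective.1)).toContinuousLinearEquiv.toContinuousAffineEquiv

theorem coe_linEquiv : ⇑T.linEquiv = T.shape.linMap T.h := rfl

/-- The rigid motion from the standard position to the element, as an affine equivalence. -/
def rigidEquiv : E d ≃ᴬ[ℝ] E d :=
  T.A.toContinuousLinearEquiv.toContinuousAffineEquiv.trans
    (ContinuousAffineEquiv.constVAdd ℝ (E d) T.b)

theorem coe_rigidEquiv : ⇑T.rigidEquiv = T.rigid := by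
  ext1 x
  exact add_comm T.b (T.A x)

/-- The map from the reference element to the element, as an affine equivalence. -/
def affineEquiv : E d ≃ᴬ[ℝ] E d := T.linEquiv.trans T.rigidEquiv

theorem coe_affineEquiv : ⇑T.affineEquiv = T.toMap := by
  rw [affineEquiv, ContinuousAffineEquiv.coe_trans, coe_rigidEquiv, coe_linEquiv]
  rfl

theorem map_rigidEquiv_volume :
    Measure.map T.rigidEquiv volume = (1 : ℝ≥0∞) • (volume : Measure (E d)) := by
  have h : ⇑T.rigidEquiv = (fun y => y + T.b) ∘ T.A := by rw [coe_rigidEquiv]; rfl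
  rw [h, ← Measure.map_map (measurable_add_const _) T.A.continuous.measurable,
    T.A.measurePreserving.map_eq, map_add_right_eq_self, one_smul]

theorem preimage_carrier : T.affineEquiv ⁻¹' T.carrier = T.shape.refElement := by
  rw [coe_affineEquiv, carrier, Set.preimage_image_eq _ T.toMap_bijective.1]

theorem linEquiv_preimage : T.linEquiv ⁻¹' (T.rigid ⁻¹' T.carrier) = T.shape.refElement := by
  rw [← T.preimage_carrier, affineEquiv, ContinuousAffineEquiv.coe_trans, Set.preimage_comp,
    coe_rigidEquiv]

theorem convex_carrier : Convex ℝ T.carrier := by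
  have h := convex_preimage_affine T.affineEquiv.symm T.shape.convex_refElement
  rw [← T.preimage_carrier] at h
  rwa [show T.affineEquiv.symm ⁻¹' (T.affineEquiv ⁻¹' T.carrier) = T.carrier by ext; simp] at h

theorem comp_toEquiv_symm_comp {φ : E d → ℝ} : (φ ∘ T.toEquiv.symm) ∘ T.affineEquiv = φ := by
  ext x
  rw [Function.comp_apply, Function.comp_apply, coe_affineEquiv]
  exact congrArg φ (T.toEquiv.symm_apply_apply x)

theorem linPart_linEquiv (k : Fin d) : linPart T.linEquiv (EuclideanSpace.single k 1) =
    T.shape.linMap T.h (EuclideanSpace.single k 1) := rfl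

theorem norm_linPart_affineEquiv (k : Fin d) :
    ‖linPart T.affineEquiv (EuclideanSpace.single k 1)‖ = T.h k := by
  rw [← T.shape.norm_linMap_single T.admissible (T.h_pos k), ← T.linPart_linEquiv]
  exact T.A.norm_map (linPart T.linEquiv (EuclideanSpace.single k 1))

theorem linPart_affineEquiv_eq_vertex_sub {i j : Fin (d + 1)} {k : Fin d}
    (h : T.shape.refVertex i - T.shape.refVertex j = EuclideanSpace.single k 1) :
    linPart T.affineEquiv (EuclideanSpace.single k 1) = T.vertex i - T.vertex j := by
  rw [← h, linPart_apply_sub, coe_affineEquiv]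
  rfl

theorem dist_vertex_eq {i j : Fin (d + 1)} {k : Fin d}
    (h : T.shape.refVertex i - T.shape.refVertex j = EuclideanSpace.single k 1) :
    dist (T.vertex i) (T.vertex j) = T.h k := by
  rw [dist_eq_norm, ← T.linPart_affineEquiv_eq_vertex_sub h, norm_linPart_affineEquiv]

/-- The columns of the shape matrix are unit vectors, so the image of e_k is an edge of length h_k.
This turns transported partial derivatives into h_k ∂/∂r_k. -/
theorem linPart_affineEquiv (k : Fin d) :
    linPart T.affineEquiv (EuclideanSpace.single k 1) = T.h k • T.dir k := by
  obtain ⟨i, j, hij, hdir⟩ := T.shape.exists_edge k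
  rw [dir, hdir, T.dist_vertex_eq hij, smul_smul, mul_inv_cancel₀ (T.h_pos k).ne', one_smul,
    T.linPart_affineEquiv_eq_vertex_sub hij]

/-- Here the vertex labelling enters: it bounds the later lengths by h_1 and so controls the first
row. The second row is controlled by the geometric condition. -/
theorem abs_matrix_mul_le {M : ℝ} (hM : 0 < M) (hT : T.shape.GeomAssumption T.h M) (i k : Fin d) :
    |T.shape.matrix i k * T.h k| ≤ (2 + M) * T.shape.weight T.h i := by
  obtain ⟨S, h, A, b, hpos, hadm, hv⟩ := T
  set T : Element d := ⟨S, h, A, b, hpos, hadm, hv⟩ with hTdef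
  have hle : ∀ {x : ℝ}, 0 ≤ x → x ≤ (2 + M) * x := fun hx => by nlinarith
  cases S with
  | triangle s t =>
    have e0 : dist (T.vertex 1) (T.vertex 0) = h 0 :=
      T.dist_vertex_eq (by ext l; fin_cases l <;> simp [hTdef, Shape.refVertex])
    have e1 : dist (T.vertex 2) (T.vertex 0) = h 1 :=
      T.dist_vertex_eq (by ext l; fin_cases l <;> simp [hTdef, Shape.refVertex])
    have h10 : h 1 ≤ h 0 := by
      rw [← e0, ← e1, dist_comm, dist_comm (T.vertex 1)]
      exact hv.2.2
    have h0 := hpos 0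
    have h1 := hpos 1
    obtain ⟨hst, ht⟩ := hadm
    have hs : |s| ≤ 1 := abs_le_one_iff_mul_self_le_one.2 (by nlinarith)
    fin_cases i <;> fin_cases k <;>
      simp only [Shape.matrix, Shape.weight, hTdef, Fin.zero_eta, Fin.mk_one, Matrix.of_apply,
        Matrix.cons_val_zero, Matrix.cons_val_one, zero_mul, abs_zero, one_mul, abs_mul]
    · rw [abs_of_pos h0]; exact hle h0.le
    · rw [abs_of_pos h1]; nlinarith
    · positivity
    · rw [abs_of_pos h1, abs_of_pos ht, mul_comm t]; exact hle (by positivity)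
  | tetraI s₁ t₁ s₂₁ s₂₂ t₂ =>
    have e0 : dist (T.vertex 1) (T.vertex 0) = h 0 :=
      T.dist_vertex_eq (by ext l; fin_cases l <;> simp [hTdef, Shape.refVertex])
    have e2 : dist (T.vertex 3) (T.vertex 0) = h 2 :=
      T.dist_vertex_eq (by ext l; fin_cases l <;> simp [hTdef, Shape.refVertex])
    have h20 : h 2 ≤ 2 * h 0 := by
      have hv1 : dist (T.vertex 0) (T.vertex 3) ≤ dist (T.vertex 0) (T.vertex 1) := hv.2.1
      rw [dist_comm, e2, dist_comm, e0] at hv1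
      have := hpos 0
      linarith
    obtain ⟨b1, b2, b3⟩ := Shape.TetraAdmissible.abs_le hadm hpos h20 hT
    obtain ⟨-, -, ht₁, -, -, ht₂, -⟩ := hadm
    exact Shape.abs_upperTriangular_mul_le hpos ht₁ ht₂ hM b1 b2 b3 i k
  | tetraII s₁ t₁ s₂₁ s₂₂ t₂ =>
    have e0 : dist (T.vertex 1) (T.vertex 0) = h 0 :=
      T.dist_vertex_eq (by ext l; fin_cases l <;> simp [hTdef, Shape.refVertex])
    have e2 : dist (T.vertex 3) (T.vertex 0) = h 2 :=
      T.dist_vertex_eq (by ext l; fin_cases l <;> simp [hTdef, Shape.refVertex])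
    -- In type (ii) the edge p_1p_4 is not compared with p_1p_2 directly. The triangle inequality
    -- through p_2 costs the factor 2.
    have h20 : h 2 ≤ 2 * h 0 := by
      have hv1 : dist (T.vertex 1) (T.vertex 3) ≤ dist (T.vertex 0) (T.vertex 1) := hv.2.2.1
      rw [dist_comm, dist_comm (T.vertex 0), e0] at hv1
      have := dist_triangle (T.vertex 3) (T.vertex 1) (T.vertex 0)
      rw [e0, e2] at this
      linarith
    obtain ⟨b1, b2, b3⟩ := Shape.TetraAdmissible.abs_le hadm hpos h20 hT
    obtain ⟨-, -, ht₁, -, -, ht₂, -⟩ := hadm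
    exact Shape.abs_upperTriangular_mul_le hpos ht₁ ht₂ hM (by rwa [abs_neg]) b2 b3 i k

end Element

/-! ### Reduction to standard position and summation of the column bounds -/

theorem normLp_weakDirDeriv_smul {d : ℕ} {K : Set (E d)} {p : ℝ≥0∞} {a : ℝ} (ha : 0 ≤ a)
    (r : E d) (f : E d → ℝ) : normLp K p (weakDirDeriv K (a • r) f) =
      ENNReal.ofReal a * normLp K p (weakDirDeriv K r f) := by
  have h : weakDirDeriv K (a • r) f = a • weakDirDeriv K r f := by
    ext x; simp [weakDirDeriv, Finset.mul_sum, mul_assoc]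
  rw [h, normLp, eLpNorm_const_smul, Real.enorm_of_nonneg ha, normLp]

theorem Element.normLp_carrier_eq {d : ℕ} (T : Element d) (q : ℝ≥0∞) (φ : E d → ℝ) :
    normLp T.carrier q (fun x => meanProj T.carrier φ - φ x) =
      normLp (T.rigid ⁻¹' T.carrier) q
        (fun x => meanProj (T.rigid ⁻¹' T.carrier) (φ ∘ T.rigid) - (φ ∘ T.rigid) x) := by
  rw [← T.coe_rigidEquiv,
    meanProj_comp_affine T.map_rigidEquiv_volume one_ne_zero ENNReal.one_ne_top]
  have h := normLp_comp_affine T.map_rigidEquiv_volume one_ne_zero T.carrier q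
    (fun x => meanProj T.carrier φ - φ x)
  rw [ENNReal.one_rpow, one_mul] at h
  exact h.symm

theorem Element.volume_rigid_preimage {d : ℕ} (T : Element d) :
    volume (T.rigid ⁻¹' T.carrier) = volume T.carrier := by
  rw [← T.coe_rigidEquiv, volume_preimage_affine T.map_rigidEquiv_volume, one_mul]

theorem Element.sum_normLp_weakDirDeriv_le {d : ℕ} (T : Element d) {M : ℝ} (hM : 0 < M)
    (hT : T.shape.GeomAssumption T.h M) {K : Set (E d)} (hK : Convex ℝ K) {p : ℝ≥0∞}
    (hp : 1 ≤ p) {f : E d → ℝ} (hf : MemW1 K p f) :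
    ∑ k, normLp K p (weakDirDeriv K (linPart T.linEquiv (EuclideanSpace.single k 1)) f) ≤
      (d * ENNReal.ofReal (2 + M)) *
        ∑ i, ENNReal.ofReal (T.shape.weight T.h i) * normLp K p (weakPartial K i f) := by
  have hk : ∀ k : Fin d,
      normLp K p (weakDirDeriv K (linPart T.linEquiv (EuclideanSpace.single k 1)) f) ≤
        ENNReal.ofReal (2 + M) *
          ∑ i, ENNReal.ofReal (T.shape.weight T.h i) * normLp K p (weakPartial K i f) := by
    intro k
    refine (hf.normLp_weakDirDeriv_le hK hp _).trans ?_
    rw [Finset.mul_sum]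
    refine Finset.sum_le_sum fun i _ => ?_
    rw [← mul_assoc, ← ENNReal.ofReal_mul (by linarith), T.linPart_linEquiv,
      Shape.linMap_single_apply, ← ofReal_norm, Real.norm_eq_abs]
    gcongr
    exact T.abs_matrix_mul_le hM hT i k
  refine (Finset.sum_le_sum fun k _ => hk k).trans (le_of_eq ?_)
  rw [Finset.sum_const, Finset.card_univ, Fintype.card_fin, nsmul_eq_mul, mul_assoc]

end AnisotropicMean

end

open AnisotropicMean in
theorem theorem1 (d : ℕ) (hd : d = 2 ∨ d = 3) (p q : ℝ≥0∞) (hp : 1 ≤ p) (hq : 1 ≤ q) :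
    (∃ c : ℝ≥0, ∀ T : Element d, W1EmbedsLp T.carrier p q →
      ∀ φhat : E d → ℝ, MemW1 T.shape.refElement p φhat →
        ∀ φ : E d → ℝ, φ = φhat ∘ T.toEquiv.symm →
          normLp T.carrier q (fun x => meanProj T.carrier φ - φ x) ≤
            c * volume T.carrier ^ (q⁻¹.toReal - p⁻¹.toReal) *
              ∑ i, ENNReal.ofReal (T.h i) *
                normLp T.carrier p (weakDirDeriv T.carrier (T.dir i) φ)) ∧
    (∀ M : ℝ, 0 < M →
      ∃ c : ℝ≥0, ∀ T : Element d, T.shape.GeomAssumption T.h M → W1EmbedsLp T.carrier p q →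
        ∀ φhat : E d → ℝ, MemW1 T.shape.refElement p φhat →
          ∀ φ : E d → ℝ, φ = φhat ∘ T.toEquiv.symm →
            normLp T.carrier q (fun x => meanProj T.carrier φ - φ x) ≤
              c * volume T.carrier ^ (q⁻¹.toReal - p⁻¹.toReal) *
                ∑ i, ENNReal.ofReal (T.shape.weight T.h i) *
                  normLp (T.rigid ⁻¹' T.carrier) p
                    (weakPartial (T.rigid ⁻¹' T.carrier) i (φ ∘ T.rigid))) := by
  obtain ⟨C, hC⟩ := Shape.exists_forall_refElement hd
    (fun K C => ∀ (F : E d ≃ᴬ[ℝ] E d) (K' : Set (E d)), F ⁻¹' K' = K → W1EmbedsLp K' p q →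
      ∀ f, MemW1 K p (f ∘ F) →
        normLp K' q (fun x => meanProj K' f - f x) ≤
          C * volume K' ^ (q⁻¹.toReal - p⁻¹.toReal) *
            ∑ i, normLp K' p (weakDirDeriv K' (linPart F (EuclideanSpace.single i 1)) f))
    (fun K C C' hCC' h F K' hK' hemb f hf => (h F K' hK' hemb f hf).trans (by gcongr))
    (fun S => exists_normLp_meanProj_sub_le_affine S.convex_refElement S.isCompact_refElement
      S.interior_refElement_nonempty hp hq)
  -- In (b), 2 + M bounds the matrix entries relative to the weights and d counts the columns.
  refine ⟨⟨C, fun T hemb φhat hφhat φ hφ => ?_⟩, fun M hM =>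
    ⟨C * (d * (2 + M).toNNReal), fun T hT hemb φhat hφhat φ hφ => ?_⟩⟩
  · have h := hC T.shape T.affineEquiv T.carrier T.preimage_carrier hemb φ
      (by rwa [hφ, T.comp_toEquiv_symm_comp])
    simp_rw [T.linPart_affineEquiv, normLp_weakDirDeriv_smul (T.h_pos _).le] at h
    exact h
  -- For (b) the scaling is applied to the linear map alone, with φ ∘ Φ_T on Φ_T⁻¹(T); the rigid
  -- motion preserves volume, norms and mean.
  · have hcomp : (φ ∘ T.rigid) ∘ T.linEquiv = φhat := by
      rw [← T.comp_toEquiv_symm_comp (φ := φhat), hφ, ← T.coe_rigidEquiv]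
      rfl
    have hK := convex_preimage_affine T.rigidEquiv T.convex_carrier
    have hemb' := hemb.preimage_affine T.convex_carrier hp T.rigidEquiv
    rw [T.coe_rigidEquiv] at hK hemb'
    have hf : MemW1 (T.rigid ⁻¹' T.carrier) p (φ ∘ T.rigid) := by
      have h1 := hφhat.comp_affine T.shape.convex_refElement T.linEquiv.symm
      rw [← hcomp, ← T.linEquiv_preimage] at h1
      have h2 : ((φ ∘ T.rigid) ∘ T.linEquiv) ∘ T.linEquiv.symm = φ ∘ T.rigid := by ext; simp
      rwa [h2, ← Set.preimage_comp, ← ContinuousAffineEquiv.coe_trans,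
        ContinuousAffineEquiv.symm_trans_self, ContinuousAffineEquiv.coe_refl,
        Set.preimage_id] at h1
    have h := hC T.shape T.linEquiv _ T.linEquiv_preimage hemb' (φ ∘ T.rigid) (by rwa [hcomp])
    rw [T.normLp_carrier_eq, ← T.volume_rigid_preimage]
    refine h.trans ?_
    calc _ ≤ _ := mul_le_mul_right (T.sum_normLp_weakDirDeriv_le hM hT hK hp hf) _
      _ = _ := by
        rw [ENNReal.coe_mul, ENNReal.coe_mul, ENNReal.coe_natCast, ENNReal.ofReal]
        ring
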